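/- Let $C$ be a bivariate copula that is twice continuously differentiable on $[0,1]^2$ (one-sided derivatives at the boundary), with partial derivatives $C_1=\partial C/\partial u$ and $C_2=\partial C/\partial v$. Let $\varphi,\psi:[0,1]\to[0,1]$ be continuous with $\varphi(1)=\psi(1)=1$, $\varphi$ strictly increasing and $\psi$ increasing (not necessarily strictly), and suppose that $$C(\varphi(u),\psi(v))\le C(\varphi(v),\psi(u))\qquad\text{for all }0\le u\le v\le 1$$ (that is, $(\varphi,\psi)\in\mathfrak S(C)$). Suppose that $\varphi$ and $\psi$ are differentiable on $[0,1]$ and that $\varphi$ is concave. Let $\varphi^{[-1]}(t)=0$ for $t\in[0,\varphi(0)]$ and $\varphi^{[-1]}(t)=\varphi^{-1}(t)$ for $t\in[\varphi(0),1]$, and put $$C_{\varphi,\psi}(u,v)=\varphi^{[-1]}\bigl(C(\varphi(u\wedge v),\psi(u\vee v))\bigr),\qquad u,v\in[0,1].$$ Put $S_1=\{(u,v)\in[0,1]^2: C(\varphi(u\wedge v),\psi(u\vee v))>\varphi(0)\}$, $S_2=\{(u,u): u\in[0,1],\ C_1(\varphi(u),\psi(u))\varphi'(u)>C_2(\varphi(u),\psi(u))\psi'(u)\}$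 and $S=S_1\cap S_2$. Let $U,V$ be random variables with joint distribution function $C_{\varphi,\psi}$ on $[0,1]^2$, and let $\mu$ be the law of $(U,V)$, with Lebesgue decomposition $\mu=\mu_s+\mu_a$ into a singular and an absolutely continuous part with respect to Lebesgue measure on $\mathbb R^2$. Let $S_{C_{\varphi,\psi}}(u,v)=\mu_s((-\infty,u]\times(-\infty,v])$ and $A_{C_{\varphi,\psi}}(u,v)=\mu_a((-\infty,u]\times(-\infty,v])$. (1) The singular set of $C_{\varphi,\psi}$, i.e. the support of $\mu_s$, contains $S$. (2) Suppose that $\varphi(0)=0$, that $S\ne\emptyset$, and that $\varphi'$ is absolutely continuous on $[0,1]$ (this holds, for instance, if $\varphi$ is twice differentiable on $(0,1)$). Then the singular component is concentrated on the main diagonal, $\mu_s\bigl(\mathbb R^2\setminus\{(u,u):u\in[0,1]\}\bigr)=0$; for all $u,v\in[0,1]$, $$C_{\varphi,\psi}(u,v)=S_{C_{\varphi,\psi}}(u,v)+A_{C_{\varphi,\psi}}(u,v),\qquad A_{C_{\varphi,\psi}}(u,v)=\int_0^u\!\int_0^v\frac{\partial}{\partial t}\frac{\partial}{\partial s}C_{\varphi,\psi}(s,t)\,dt\,ds;$$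 and $$\mathbb P(U=V)=S_{C_{\varphi,\psi}}(1,1)=1-A_{C_{\varphi,\psi}}(1,1).$$ -/

import Mathlib

open Set MeasureTheory

noncomputable section

namespace TransformedCopula

/-- A bivariate copula, as a function of two real variables of which only the values on
`[0,1]²` matter: it is grounded, has uniform margins and is 2-increasing. -/
structure IsCopula (C : ℝ → ℝ → ℝ) : Prop where
  zero_left : ∀ v ∈ Icc (0 : ℝ) 1, C 0 v = 0
  zero_right : ∀ u ∈ Icc (0 : ℝ) 1, C u 0 = 0
  one_left : ∀ v ∈ Icc (0 : ℝ) 1, C 1 v = v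
  one_right : ∀ u ∈ Icc (0 : ℝ) 1, C u 1 = u
  two_increasing : ∀ u₁ ∈ Icc (0 : ℝ) 1, ∀ u₂ ∈ Icc (0 : ℝ) 1,
    ∀ v₁ ∈ Icc (0 : ℝ) 1, ∀ v₂ ∈ Icc (0 : ℝ) 1, u₁ ≤ u₂ → v₁ ≤ v₂ →
      0 ≤ C u₂ v₂ - C u₁ v₂ - C u₂ v₁ + C u₁ v₁

/-- The class `Ψ`: continuous increasing `ψ : [0,1] → [0,1]` with `ψ(1) = 1`. -/
def classPsi : Set (ℝ → ℝ) :=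
  {ψ | MapsTo ψ (Icc 0 1) (Icc 0 1) ∧ ContinuousOn ψ (Icc 0 1) ∧
    MonotoneOn ψ (Icc 0 1) ∧ ψ 1 = 1}

/-- The class `Φ`: continuous strictly increasing `φ : [0,1] → [0,1]` with `φ(1) = 1`. -/
def classPhi : Set (ℝ → ℝ) :=
  {φ | MapsTo φ (Icc 0 1) (Icc 0 1) ∧ ContinuousOn φ (Icc 0 1) ∧
    StrictMonoOn φ (Icc 0 1) ∧ φ 1 = 1}

/-- The class `𝔖(C)` of pairs `(φ, ψ) ∈ Φ × Ψ` with `C(φ(u), ψ(v)) ≤ C(φ(v), ψ(u))` for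
`0 ≤ u ≤ v ≤ 1`. -/
def classS (C : ℝ → ℝ → ℝ) : Set ((ℝ → ℝ) × (ℝ → ℝ)) :=
  {p | p.1 ∈ classPhi ∧ p.2 ∈ classPsi ∧
    ∀ u ∈ Icc (0 : ℝ) 1, ∀ v ∈ Icc (0 : ℝ) 1, u ≤ v → C (p.1 u) (p.2 v) ≤ C (p.1 v) (p.2 u)}

open Classical in
/-- The pseudo-inverse `φ^{[-1]}` on `[0,1]`: zero on `[0, φ(0)]`, and the inverse of
`φ : [0,1] → [φ(0), 1]` on `[φ(0), 1]`. -/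
def pseudoInverse (φ : ℝ → ℝ) (t : ℝ) : ℝ :=
  if t ≤ φ 0 then 0 else Function.invFunOn φ (Icc 0 1) t

/-- The transformed function `C_{φ,ψ}(u,v) = φ^{[-1]}(C(φ(u ∧ v), ψ(u ∨ v)))`. -/
def transformed (C : ℝ → ℝ → ℝ) (φ ψ : ℝ → ℝ) (u v : ℝ) : ℝ :=
  pseudoInverse φ (C (φ (min u v)) (ψ (max u v)))

/-- The partial derivative `C₁ = ∂C/∂u` on `[0,1]²` (one-sided at the end points). -/
def partial₁ (C : ℝ → ℝ → ℝ) (u v : ℝ) : ℝ :=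
  derivWithin (fun s => C s v) (Icc 0 1) u

/-- The partial derivative `C₂ = ∂C/∂v` on `[0,1]²` (one-sided at the end points). -/
def partial₂ (C : ℝ → ℝ → ℝ) (u v : ℝ) : ℝ :=
  derivWithin (fun t => C u t) (Icc 0 1) v

/-- The set `S₁ = {(u,v) ∈ [0,1]² : C(φ(u ∧ v), ψ(u ∨ v)) > φ(0)}`. -/
def setS₁ (C : ℝ → ℝ → ℝ) (φ ψ : ℝ → ℝ) : Set (ℝ × ℝ) :=
  {p | p.1 ∈ Icc (0 : ℝ) 1 ∧ p.2 ∈ Icc (0 : ℝ) 1 ∧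
    φ 0 < C (φ (min p.1 p.2)) (ψ (max p.1 p.2))}

/-- The set `S₂ = {(u,u) : C₁(φ(u),ψ(u)) φ'(u) > C₂(φ(u),ψ(u)) ψ'(u), u ∈ [0,1]}`. -/
def setS₂ (C : ℝ → ℝ → ℝ) (φ ψ : ℝ → ℝ) : Set (ℝ × ℝ) :=
  {p | ∃ u ∈ Icc (0 : ℝ) 1, p = (u, u) ∧
    partial₂ C (φ u) (ψ u) * derivWithin ψ (Icc 0 1) u
      < partial₁ C (φ u) (ψ u) * derivWithin φ (Icc 0 1) u}

/-- The set `S = S₁ ∩ S₂`. -/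
def setS (C : ℝ → ℝ → ℝ) (φ ψ : ℝ → ℝ) : Set (ℝ × ℝ) :=
  setS₁ C φ ψ ∩ setS₂ C φ ψ

/-- The main diagonal `{(u,u) : u ∈ [0,1]}` of the unit square. -/
def mainDiagonal : Set (ℝ × ℝ) :=
  {p | ∃ u ∈ Icc (0 : ℝ) 1, p = (u, u)}

/-- The random variables `U` and `V` have joint distribution function `H` on `[0,1]²`. For a
copula `H` this determines the law of `(U, V)`, since `H(1,1) = 1`. -/
def HasJointDistribution {Ω : Type*} [MeasurableSpace Ω] (P : Measure Ω) (U V : Ω → ℝ)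
    (H : ℝ → ℝ → ℝ) : Prop :=
  ∀ u ∈ Icc (0 : ℝ) 1, ∀ v ∈ Icc (0 : ℝ) 1, P.real {ω | U ω ≤ u ∧ V ω ≤ v} = H u v

/-- The joint law of `(U, V)` on the plane. -/
def jointLaw {Ω : Type*} [MeasurableSpace Ω] (P : Measure Ω) (U V : Ω → ℝ) :
    Measure (ℝ × ℝ) :=
  P.map fun ω => (U ω, V ω)

/-- The singular part, in the Lebesgue decomposition with respect to planar Lebesgue measure,
of a finite measure on the plane. -/
def singularMeasure (μ : Measure (ℝ × ℝ)) : Measure (ℝ × ℝ) :=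
  μ.singularPart volume

/-- The absolutely continuous part, in the Lebesgue decomposition with respect to planar Lebesgue
measure, of a finite measure on the plane. -/
def acMeasure (μ : Measure (ℝ × ℝ)) : Measure (ℝ × ℝ) :=
  volume.withDensity (μ.rnDeriv volume)

/-- The singular component, as a distribution function. -/
def singularComponent (μ : Measure (ℝ × ℝ)) (u v : ℝ) : ℝ :=
  (singularMeasure μ).real (Iic u ×ˢ Iic v)

/-- The absolutely continuous component, as a distribution function. -/
def acComponent (μ : Measure (ℝ × ℝ)) (u v : ℝ) : ℝ :=
  (acMeasure μ).real (Iic u ×ˢ Iic v)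

/-- The singular set: the support of the singular part. -/
def singularSet (μ : Measure (ℝ × ℝ)) : Set (ℝ × ℝ) :=
  (singularMeasure μ).support

/-- The mixed second derivative `∂²H/∂s∂t` at `(s, t)`: differentiate in the first variable, then
in the second. -/
def mixedDeriv (H : ℝ → ℝ → ℝ) (s t : ℝ) : ℝ :=
  deriv (fun t' => deriv (fun s' => H s' t') s) t

end TransformedCopula

end

/-!
Write `H = C_{φ,ψ}` and let `μ` be the law with distribution function `H`. The diagonal is a Lebesgue
null set, so whatever mass `μ` puts on it belongs to the singular part.

For the first claim it is therefore enough that `μ` charges the diagonal near each point `(u, u)` of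
`S`. For a partition of `(a, u]`, the squares along the diagonal have total mass
`H(u,u) - H(a,a) - 2 ∑ (H(xᵢ,xᵢ₊₁) - H(xᵢ,xᵢ))`. Let `q = φ'(H(u,u))`, which is positive on `S`.
By concavity of `φ` the increments in the sum are at most `q⁻¹ M (ψ(xᵢ₊₁) - ψ(xᵢ))`, where `M`
bounds `C₂` near the point, and the sum telescopes. Refining the partition bounds the mass of the
diagonal over `(a, u]` from below by `H(u,u) - H(a,a) - 2 q⁻¹ M (ψ(u) - ψ(a))`
(`le_measureReal_diagonal`), and as `a` increases to `u` this is
`q⁻¹ (C₁ φ' - C₂ ψ') (u - a)` up to an error that is small relative to `u - a`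
(`eventually_measureReal_diagonal_pos`).

For the second claim, `μ` is disintegrated over its first margin, which is uniform, into conditional
laws `κ_s`. By Lebesgue's differentiation theorem the distribution function of `κ_s` is
`∂H/∂s (s, ·)` at all rational points, for almost every `s` (`ae_condKernel_Iic_rat`). This
derivative is `C₁(φ(s), ψ(t)) φ'(s) / φ'(H(s,t))` for `s < t` and
`C₂(φ(t), ψ(s)) ψ'(s) / φ'(H(s,t))` for `t < s`. Both are absolutely continuous in `t`: the
numerators because `C` is twice continuously differentiable and because a monotone function with a
derivative everywhere is absolutely continuous, the denominator because it is the absolutely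
continuous `φ'` after the monotone, absolutely continuous `H(s, ·)`, and is at least `φ'(s) > 0`
(`partial_transformed_ac_left`, `partial_transformed_ac_right`). Hence `κ_s` has density
`∂²H/∂s∂t (s, ·)` off the point `s` (`ae_condKernel_restrict_eq_withDensity`). So `μ` is absolutely
continuous off the diagonal, the Lebesgue decomposition is the restriction to the diagonal and to
its complement, and integrating over `s` gives the formula for the absolutely continuous component.
-/

namespace TransformedCopula

open Filter Topology

/-! ### Absolutely continuous functions -/

theorem _root_.AbsolutelyContinuousOnInterval.congr {f h : ℝ → ℝ} {a b : ℝ}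
    (hf : AbsolutelyContinuousOnInterval f a b) (hfh : EqOn f h (uIcc a b)) :
    AbsolutelyContinuousOnInterval h a b := by
  rw [absolutelyContinuousOnInterval_iff] at hf ⊢
  intro ε hε
  obtain ⟨δ, hδ, H⟩ := hf ε hε
  refine ⟨δ, hδ, fun E hE hsum => ?_⟩
  convert H E hE hsum using 2 with i hi
  rw [hfh (hE.1 i hi).1, hfh (hE.1 i hi).2]

theorem _root_.AbsolutelyContinuousOnInterval.comp_monotoneOn {f h : ℝ → ℝ} {a b c d : ℝ}
    (hf : AbsolutelyContinuousOnInterval f c d) (hh : AbsolutelyContinuousOnInterval h a b)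
    (hmono : MonotoneOn h (uIcc a b)) (hmaps : MapsTo h (uIcc a b) (uIcc c d)) :
    AbsolutelyContinuousOnInterval (fun x => f (h x)) a b := by
  rw [absolutelyContinuousOnInterval_iff] at hf hh ⊢
  intro ε hε
  obtain ⟨δ, hδ, H⟩ := hf ε hε
  obtain ⟨η, hη, H'⟩ := hh δ hδ
  refine ⟨η, hη, fun E hE hsum => ?_⟩
  refine H (E.1, fun i => (h (E.2 i).1, h (E.2 i).2)) ⟨fun i hi => ?_, ?_⟩ (H' E hE hsum)
  · exact ⟨hmaps (hE.1 i hi).1, hmaps (hE.1 i hi).2⟩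
  · intro i hi j hj hij
    have hd := hE.2 hi hj hij
    have hi' := hE.1 i hi
    have hj' := hE.1 j hj
    simp only [Function.onFun, uIoc, Ioc_disjoint_Ioc] at hd ⊢
    -- A monotone map commutes with `min` and `max`.
    have key : ∀ x ∈ uIcc a b, ∀ y ∈ uIcc a b,
        h (min x y) = min (h x) (h y) ∧ h (max x y) = max (h x) (h y) := fun x hx y hy => by
      rcases le_total x y with hxy | hxy
      · have := hmono hx hy hxy
        simp [hxy, this]
      · have := hmono hy hx hxy
        simp [hxy, this]
    have hmin : ∀ x ∈ uIcc a b, ∀ y ∈ uIcc a b, min x y ∈ uIcc a b := fun x hx y hy => by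
      rcases min_choice x y with h | h <;> rwa [h]
    have hmax : ∀ x ∈ uIcc a b, ∀ y ∈ uIcc a b, max x y ∈ uIcc a b := fun x hx y hy => by
      rcases max_choice x y with h | h <;> rwa [h]
    rw [← (key _ hi'.1 _ hi'.2).1, ← (key _ hi'.1 _ hi'.2).2, ← (key _ hj'.1 _ hj'.2).1,
      ← (key _ hj'.1 _ hj'.2).2]
    have m1 := hmin _ hi'.1 _ hi'.2
    have m2 := hmax _ hi'.1 _ hi'.2
    have m3 := hmin _ hj'.1 _ hj'.2
    have m4 := hmax _ hj'.1 _ hj'.2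
    rw [← (key _ m2 _ m4).1, ← (key _ m1 _ m3).2]
    exact hmono (hmin _ m2 _ m4) (hmax _ m1 _ m3) hd

theorem _root_.LipschitzOnWith.comp_absolutelyContinuousOnInterval {f h : ℝ → ℝ} {a b : ℝ}
    {K : NNReal} {s : Set ℝ} (hf : LipschitzOnWith K f s)
    (hh : AbsolutelyContinuousOnInterval h a b) (hmaps : MapsTo h (uIcc a b) s) :
    AbsolutelyContinuousOnInterval (fun x => f (h x)) a b := by
  rw [absolutelyContinuousOnInterval_iff] at hh ⊢
  intro ε hε
  obtain ⟨δ, hδ, H⟩ := hh (ε / (K + 1)) (by positivity)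
  refine ⟨δ, hδ, fun E hE hsum => ?_⟩
  have h1 := H E hE hsum
  rw [lt_div_iff₀ (by positivity), Finset.sum_mul] at h1
  refine lt_of_le_of_lt (Finset.sum_le_sum fun i hi => ?_) h1
  have h2 := hf.dist_le_mul _ (hmaps (hE.1 i hi).1) _ (hmaps (hE.1 i hi).2)
  have h3 : 0 ≤ dist (h (E.2 i).1) (h (E.2 i).2) := dist_nonneg
  linarith

theorem _root_.AbsolutelyContinuousOnInterval.inv_of_le {f : ℝ → ℝ} {a b m : ℝ} (hm : 0 < m)
    (hf : AbsolutelyContinuousOnInterval f a b) (hle : ∀ x ∈ uIcc a b, m ≤ f x) :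
    AbsolutelyContinuousOnInterval (fun x => (f x)⁻¹) a b := by
  have hLip : LipschitzOnWith ⟨1 / m ^ 2, by positivity⟩ (fun y : ℝ => y⁻¹) (Ici m) := by
    refine LipschitzOnWith.of_dist_le_mul fun x hx y hy => ?_
    have hx0 : 0 < x := hm.trans_le hx
    have hy0 : 0 < y := hm.trans_le hy
    rw [Real.dist_eq, Real.dist_eq, inv_sub_inv hx0.ne' hy0.ne', abs_div, abs_of_pos (mul_pos hx0 hy0),
      abs_sub_comm y x]
    change |x - y| / (x * y) ≤ 1 / m ^ 2 * |x - y|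
    rw [div_eq_mul_one_div, mul_comm]
    gcongr
    rw [sq]
    exact mul_le_mul hx hy hm.le hx0.le
  exact hLip.comp_absolutelyContinuousOnInterval hf hle

/-- A monotone function which is differentiable at every point of `[a, b]`, and not merely almost
everywhere, is absolutely continuous. -/
theorem absolutelyContinuousOnInterval_of_monotoneOn_differentiableOn {f : ℝ → ℝ} {a b : ℝ}
    (hab : a ≤ b) (hmono : MonotoneOn f (Icc a b)) (hd : DifferentiableOn ℝ f (Icc a b)) :
    AbsolutelyContinuousOnInterval f a b := by
  have hder : ∀ x ∈ Ioo a b, HasDerivAt f (deriv f x) x := fun x hx =>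
    ((hd x (Ioo_subset_Icc_self hx)).differentiableAt (Icc_mem_nhds hx.1 hx.2)).hasDerivAt
  have hnn : ∀ x ∈ Ioo a b, 0 ≤ deriv f x := fun x hx => by
    rw [← derivWithin_of_mem_nhds (Icc_mem_nhds hx.1 hx.2)]
    exact hmono.derivWithin_nonneg
  have hint : IntervalIntegrable (deriv f) volume a b :=
    (intervalIntegrable_iff_integrableOn_Ioc_of_le hab).2
      (intervalIntegral.integrableOn_deriv_of_nonneg hd.continuousOn hder hnn)
  have hAC := hint.absolutelyContinuousOnInterval_intervalIntegral (c := a) (by simp)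
  have hLip : LipschitzOnWith 1 (fun y : ℝ => f a + y) univ :=
    LipschitzOnWith.of_dist_le_mul fun x _ y _ => by simp
  refine (hLip.comp_absolutelyContinuousOnInterval hAC (mapsTo_univ _ _)).congr fun x hx => ?_
  rw [uIcc_of_le hab] at hx
  simp only
  rw [intervalIntegral.integral_eq_sub_of_hasDerivAt_of_le hx.1
    (hd.continuousOn.mono (Icc_subset_Icc_right hx.2))
    (fun y hy => hder y ⟨hy.1, hy.2.trans_le hx.2⟩)
    (hint.mono_set (by rw [uIcc_of_le hx.1, uIcc_of_le hab]; exact Icc_subset_Icc_right hx.2))]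
  ring

/-! ### Measures on the line with a piecewise absolutely continuous distribution function -/

/-- If the distribution function of `ν` agrees on `(a, b)` with a function absolutely continuous on
`[a, b]`, then `ν` has the derivative as its density on the open interval; atoms at `a` and `b` are
allowed. -/
theorem restrict_Ioo_eq_withDensity_deriv {ν : Measure ℝ} [IsProbabilityMeasure ν] {k : ℝ → ℝ}
    {a b : ℝ} (hab : a < b) (hk : AbsolutelyContinuousOnInterval k a b)
    (hν : ∀ t ∈ Ioo a b, ν.real (Iic t) = k t) :
    (∀ t ∈ Ioo a b, 0 ≤ deriv k t) ∧ IntegrableOn (deriv k) (Ioo a b) ∧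
    ν.restrict (Ioo a b) =
      (volume.restrict (Ioo a b)).withDensity fun t => ENNReal.ofReal (deriv k t) := by
  have hcdf : ∀ t ∈ Ioo a b, ProbabilityTheory.cdf ν t = k t := fun t ht => by
    rw [ProbabilityTheory.cdf_eq_real, hν t ht]
  have hcont : ContinuousOn k (Icc a b) := by simpa [uIcc_of_le hab.le] using hk.continuousOn
  have hnn : ∀ t ∈ Ioo a b, 0 ≤ deriv k t := fun t ht => by
    have h1 : k =ᶠ[𝓝 t] ProbabilityTheory.cdf ν := by
      filter_upwards [Ioo_mem_nhds ht.1 ht.2] with x hx using (hcdf x hx).symm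
    rw [h1.deriv_eq]
    exact (ProbabilityTheory.monotone_cdf ν).deriv_nonneg
  have hint : IntegrableOn (deriv k) (Ioo a b) := by
    rw [← integrableOn_Ioc_iff_integrableOn_Ioo,
      ← intervalIntegrable_iff_integrableOn_Ioc_of_le hab.le]
    exact hk.intervalIntegrable_deriv
  refine ⟨hnn, hint, ?_⟩
  have ha : ProbabilityTheory.cdf ν a = k a := by
    have h1 : Tendsto (ProbabilityTheory.cdf ν) (𝓝[>] a) (𝓝 (ProbabilityTheory.cdf ν a)) :=
      ((ProbabilityTheory.cdf ν).right_continuous a).tendsto.mono_left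
        (nhdsWithin_mono _ Ioi_subset_Ici_self)
    have h2 : Tendsto k (𝓝[>] a) (𝓝 (k a)) := by
      rw [← nhdsWithin_Ioo_eq_nhdsGT hab]
      exact (hcont a (left_mem_Icc.2 hab.le)).mono Ioo_subset_Icc_self
    refine tendsto_nhds_unique h1 (h2.congr' ?_)
    filter_upwards [Ioo_mem_nhdsGT hab] with x hx using (hcdf x hx).symm
  have hleft : ∀ t ∈ Ioc a b, Function.leftLim (ProbabilityTheory.cdf ν) t = k t := fun t ht => by
    refine leftLim_eq_of_tendsto ?_
    have h2 : Tendsto k (𝓝[<] t) (𝓝 (k t)) := by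
      rw [← nhdsWithin_Ioo_eq_nhdsLT ht.1]
      exact (hcont t ⟨ht.1.le, ht.2⟩).mono fun x hx => ⟨hx.1.le, hx.2.le.trans ht.2⟩
    refine h2.congr' ?_
    filter_upwards [Ioo_mem_nhdsLT ht.1] with x hx using (hcdf x ⟨hx.1, hx.2.trans_le ht.2⟩).symm
  have hIoo : ∀ t ∈ Ioc a b, ν (Ioo a t) = ∫⁻ x in Ioo a t, ENNReal.ofReal (deriv k x) :=
      fun t ht => by
    rw [← ofReal_integral_eq_lintegral_ofReal (hint.mono_set (Ioo_subset_Ioo_right ht.2)),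
      ← integral_Ioc_eq_integral_Ioo, ← intervalIntegral.integral_of_le ht.1.le,
      (hk.mono ?_).integral_deriv_eq_sub]
    · conv_lhs => rw [← ProbabilityTheory.measure_cdf ν]
      rw [StieltjesFunction.measure_Ioo, hleft t ht, ha]
    · rw [uIcc_of_le ht.1.le, uIcc_of_le hab.le]
      exact Icc_subset_Icc_right ht.2
    · filter_upwards [ae_restrict_mem measurableSet_Ioo] with x hx
        using hnn x ⟨hx.1, hx.2.trans_le ht.2⟩
  refine ext_of_generate_finite (range Iio) ((borel_eq_generateFrom_Iio ℝ) ▸ BorelSpace.measurable_eq)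
    isPiSystem_Iio ?_ ?_
  · rintro _ ⟨t, rfl⟩
    rw [Measure.restrict_apply measurableSet_Iio, withDensity_apply _ measurableSet_Iio,
      Measure.restrict_restrict measurableSet_Iio]
    have hset : Iio t ∩ Ioo a b = Ioo a (min b t) := by
      ext x
      simp only [mem_inter_iff, mem_Iio, mem_Ioo, lt_min_iff]
      tauto
    rw [hset]
    rcases le_or_gt (min b t) a with h | h
    · simp [Ioo_eq_empty_of_le h]
    · exact hIoo _ ⟨h, min_le_left _ _⟩
  · rw [Measure.restrict_apply MeasurableSet.univ, withDensity_apply _ MeasurableSet.univ,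
      univ_inter, Measure.restrict_univ]
    exact hIoo b (right_mem_Ioc.2 hab)

/-! ### Mass of the diagonal -/

theorem measurableSet_diagonal_real : MeasurableSet (diagonal ℝ) := isClosed_diagonal.measurableSet

theorem volume_diagonal_real : volume (diagonal ℝ) = 0 := by
  rw [Measure.volume_eq_prod, Measure.measure_prod_null measurableSet_diagonal_real]
  filter_upwards with x
  have : Prod.mk x ⁻¹' diagonal ℝ = {x} := by
    ext y
    simp [eq_comm]
  simp [this]

theorem measureReal_Ioc_prod_Ioc (μ : Measure (ℝ × ℝ)) [IsFiniteMeasure μ] {a b c d : ℝ}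
    (hab : a ≤ b) (hcd : c ≤ d) :
    μ.real (Ioc a b ×ˢ Ioc c d) = μ.real (Iic b ×ˢ Iic d) - μ.real (Iic a ×ˢ Iic d)
      - μ.real (Iic b ×ˢ Iic c) + μ.real (Iic a ×ˢ Iic c) := by
  have h1 : ∀ t, μ.real (Ioc a b ×ˢ Iic t) = μ.real (Iic b ×ˢ Iic t) - μ.real (Iic a ×ˢ Iic t) := by
    intro t
    rw [← measureReal_sdiff (prod_mono (Iic_subset_Iic.2 hab) le_rfl)
      (measurableSet_Iic.prod measurableSet_Iic)]
    congr 1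
    ext p
    simp only [mem_prod, mem_Ioc, mem_Iic, Set.mem_sdiff]
    constructor
    · rintro ⟨⟨h1, h2⟩, h3⟩
      exact ⟨⟨h2, h3⟩, fun h => absurd h.1 (not_le.2 h1)⟩
    · rintro ⟨⟨h1, h2⟩, h3⟩
      exact ⟨⟨not_le.1 fun h => h3 ⟨h, h2⟩, h1⟩, h2⟩
  have h2 : μ.real (Ioc a b ×ˢ Ioc c d) = μ.real (Ioc a b ×ˢ Iic d) - μ.real (Ioc a b ×ˢ Iic c) := by
    rw [← measureReal_sdiff (prod_mono le_rfl (Iic_subset_Iic.2 hcd))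
      (measurableSet_Ioc.prod measurableSet_Iic)]
    congr 1
    ext p
    simp only [mem_prod, mem_Ioc, mem_Iic, Set.mem_sdiff]
    constructor
    · rintro ⟨h1, h2, h3⟩
      exact ⟨⟨h1, h3⟩, fun h => absurd h.2 (not_le.2 h2)⟩
    · rintro ⟨⟨h1, h2⟩, h3⟩
      exact ⟨h1, not_le.1 fun h => h3 ⟨h1, h⟩, h2⟩
  rw [h2, h1, h1]
  ring

/-- If the squares `(x, y]²` with `a ≤ x ≤ y ≤ b` have mass at least `G y - G x`, so has the part of
the diagonal above `(a, b]`: it is the decreasing limit of bands, and the band of width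
`(b - a) / (n + 1)` contains the `n + 1` squares of a uniform partition. -/
theorem le_measureReal_diagonal (μ : Measure (ℝ × ℝ)) [IsFiniteMeasure μ] {a b : ℝ} (hab : a ≤ b)
    {G : ℝ → ℝ}
    (hG : ∀ x y, a ≤ x → x ≤ y → y ≤ b → G y - G x ≤ μ.real (Ioc x y ×ˢ Ioc x y)) :
    G b - G a ≤ μ.real ((Ioc a b ×ˢ Ioc a b) ∩ diagonal ℝ) := by
  let E : ℕ → Set (ℝ × ℝ) := fun n => (Ioc a b ×ˢ Ioc a b) ∩ {p | |p.1 - p.2| ≤ (b - a) / (n + 1)}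
  have hEm : ∀ n, MeasurableSet (E n) := fun n =>
    (measurableSet_Ioc.prod measurableSet_Ioc).inter
      (measurableSet_le (by fun_prop) measurable_const)
  have hanti : Antitone E := by
    intro m n hmn p hp
    refine ⟨hp.1, ?_⟩
    refine (show |p.1 - p.2| ≤ (b - a) / (n + 1) from hp.2).trans ?_
    have : (m : ℝ) ≤ n := by exact_mod_cast hmn
    have := sub_nonneg.2 hab
    gcongr
  have hinter : ⋂ n, E n = (Ioc a b ×ˢ Ioc a b) ∩ diagonal ℝ := by
    ext p
    simp only [E, mem_iInter, mem_inter_iff, mem_ofPred_eq, mem_diagonal_iff]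
    constructor
    · intro h
      refine ⟨(h 0).1, ?_⟩
      have h0 : |p.1 - p.2| ≤ 0 := by
        refine ge_of_tendsto' (x := atTop) (f := fun n : ℕ => (b - a) / ((n : ℝ) + 1)) ?_
          fun n => (h n).2
        have := (tendsto_one_div_add_atTop_nhds_zero_nat (𝕜 := ℝ)).const_mul (b - a)
        simpa [div_eq_mul_inv] using this
      exact sub_eq_zero.1 (abs_eq_zero.1 (le_antisymm h0 (abs_nonneg _)))
    · rintro ⟨h1, h2⟩ n
      refine ⟨h1, ?_⟩
      rw [h2, sub_self, abs_zero]
      have := sub_nonneg.2 hab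
      positivity
  have hlim : Tendsto (fun n => μ.real (E n)) atTop
      (𝓝 (μ.real ((Ioc a b ×ˢ Ioc a b) ∩ diagonal ℝ))) := by
    rw [← hinter]
    exact (ENNReal.tendsto_toReal (measure_ne_top _ _)).comp
      (tendsto_measure_iInter_atTop (fun n => (hEm n).nullMeasurableSet) hanti
        ⟨0, measure_ne_top _ _⟩)
  refine ge_of_tendsto' hlim fun n => ?_
  let δ : ℝ := (b - a) / (n + 1)
  have hδ : 0 ≤ δ := div_nonneg (sub_nonneg.2 hab) (by positivity)
  let x : ℕ → ℝ := fun i => a + i * δ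
  have hx0 : x 0 = a := by simp [x]
  have hxn : x (n + 1) = b := by
    simp only [x, δ]
    push_cast
    field_simp
    ring
  have hxmono : Monotone x := fun i j hij => by
    have : (i : ℝ) ≤ j := by exact_mod_cast hij
    simp only [x]
    gcongr
  have hxs : ∀ i, x (i + 1) = x i + δ := fun i => by
    simp only [x]
    push_cast
    ring
  have hdisj : ((Finset.range (n + 1) : Finset ℕ) : Set ℕ).PairwiseDisjoint
      fun i => Ioc (x i) (x (i + 1)) ×ˢ Ioc (x i) (x (i + 1)) := fun i _ j _ hij => by
    exact Disjoint.set_prod_left (hxmono.pairwise_disjoint_on_Ioc_succ hij) _ _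
  have hsub : (⋃ i ∈ Finset.range (n + 1), Ioc (x i) (x (i + 1)) ×ˢ Ioc (x i) (x (i + 1))) ⊆ E n := by
    intro p hp
    simp only [mem_iUnion, Finset.mem_range] at hp
    obtain ⟨i, hi, hp1, hp2⟩ := hp
    have hl : a ≤ x i := hx0 ▸ hxmono (Nat.zero_le i)
    have hr : x (i + 1) ≤ b := hxn ▸ hxmono hi
    refine ⟨⟨⟨hl.trans_lt hp1.1, hp1.2.trans hr⟩, ⟨hl.trans_lt hp2.1, hp2.2.trans hr⟩⟩, ?_⟩
    have h1 := hp1.1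
    have h2 := hp1.2
    have h3 := hp2.1
    have h4 := hp2.2
    rw [hxs] at h2 h4
    change |p.1 - p.2| ≤ δ
    rw [abs_le]
    constructor <;> linarith
  calc G b - G a = ∑ i ∈ Finset.range (n + 1), (G (x (i + 1)) - G (x i)) := by
        rw [Finset.sum_range_sub (fun i => G (x i)), hx0, hxn]
    _ ≤ ∑ i ∈ Finset.range (n + 1), μ.real (Ioc (x i) (x (i + 1)) ×ˢ Ioc (x i) (x (i + 1))) := by
        refine Finset.sum_le_sum fun i hi => hG _ _ (hx0 ▸ hxmono (Nat.zero_le i))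
          (hxmono i.le_succ) (hxn ▸ hxmono (Finset.mem_range.1 hi))
    _ = μ.real (⋃ i ∈ Finset.range (n + 1), Ioc (x i) (x (i + 1)) ×ˢ Ioc (x i) (x (i + 1))) :=
        (measureReal_biUnion_finset hdisj fun _ _ => measurableSet_Ioc.prod measurableSet_Ioc).symm
    _ ≤ μ.real (E n) := measureReal_mono hsub

/-- The diagonal is a Lebesgue null set, so all the mass it carries belongs to the singular part. -/
theorem singularMeasure_inter_diagonal (μ : Measure (ℝ × ℝ)) [IsFiniteMeasure μ]
    (B : Set (ℝ × ℝ)) : singularMeasure μ (B ∩ diagonal ℝ) = μ (B ∩ diagonal ℝ) := by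
  conv_rhs => rw [μ.haveLebesgueDecomposition_add volume]
  rw [Measure.add_apply, singularMeasure, withDensity_absolutelyContinuous volume _
    (measure_mono_null inter_subset_right volume_diagonal_real), add_zero]

/-- If the mass off the diagonal is absolutely continuous, the Lebesgue decomposition splits a
measure into its restrictions to the diagonal and to the complement of the diagonal. -/
theorem lebesgueDecomposition_of_restrict_compl_diagonal_ac (μ : Measure (ℝ × ℝ))
    [IsFiniteMeasure μ] (h : μ.restrict (diagonal ℝ)ᶜ ≪ volume) :
    singularMeasure μ = μ.restrict (diagonal ℝ) ∧ acMeasure μ = μ.restrict (diagonal ℝ)ᶜ := by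
  have hsing : μ.restrict (diagonal ℝ) ⟂ₘ volume :=
    ⟨(diagonal ℝ)ᶜ, measurableSet_diagonal_real.compl, by
      rw [Measure.restrict_apply measurableSet_diagonal_real.compl, compl_inter_self, measure_empty],
      by rw [compl_compl, volume_diagonal_real]⟩
  have hdens := Measure.withDensity_rnDeriv_eq _ _ h
  have hadd : μ = μ.restrict (diagonal ℝ) +
      volume.withDensity ((μ.restrict (diagonal ℝ)ᶜ).rnDeriv volume) := by
    rw [hdens, Measure.restrict_add_restrict_compl measurableSet_diagonal_real]
  refine ⟨(Measure.eq_singularPart (Measure.measurable_rnDeriv _ _) hsing hadd).symm, ?_⟩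
  rw [acMeasure, ← Measure.eq_withDensity_rnDeriv (Measure.measurable_rnDeriv _ _) hsing hadd, hdens]

/-! ### Copulas -/

namespace IsCopula

variable {C : ℝ → ℝ → ℝ} (hC : IsCopula C)
include hC

theorem mono_left {u₁ u₂ v : ℝ} (h₁ : u₁ ∈ Icc (0 : ℝ) 1) (h₂ : u₂ ∈ Icc (0 : ℝ) 1)
    (hv : v ∈ Icc (0 : ℝ) 1) (h : u₁ ≤ u₂) : C u₁ v ≤ C u₂ v := by
  have h0 : (0 : ℝ) ∈ Icc (0 : ℝ) 1 := by simp
  have := hC.two_increasing u₁ h₁ u₂ h₂ 0 h0 v hv h hv.1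
  rw [hC.zero_right _ h₁, hC.zero_right _ h₂] at this
  linarith

theorem mono_right {u v₁ v₂ : ℝ} (hu : u ∈ Icc (0 : ℝ) 1) (h₁ : v₁ ∈ Icc (0 : ℝ) 1)
    (h₂ : v₂ ∈ Icc (0 : ℝ) 1) (h : v₁ ≤ v₂) : C u v₁ ≤ C u v₂ := by
  have h0 : (0 : ℝ) ∈ Icc (0 : ℝ) 1 := by simp
  have := hC.two_increasing 0 h0 u hu v₁ h₁ v₂ h₂ hu.1 h
  rw [hC.zero_left _ h₁, hC.zero_left _ h₂] at this
  linarith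

theorem le_left {u v : ℝ} (hu : u ∈ Icc (0 : ℝ) 1) (hv : v ∈ Icc (0 : ℝ) 1) : C u v ≤ u :=
  (hC.mono_right hu hv (by simp) hv.2).trans_eq (hC.one_right u hu)

theorem mem_Icc {u v : ℝ} (hu : u ∈ Icc (0 : ℝ) 1) (hv : v ∈ Icc (0 : ℝ) 1) :
    C u v ∈ Icc (0 : ℝ) 1 :=
  ⟨(hC.zero_right u hu).symm.trans_le (hC.mono_right hu (by simp) hv hv.1),
    (hC.le_left hu hv).trans hu.2⟩

theorem partial₂_nonneg {u v : ℝ} (hu : u ∈ Icc (0 : ℝ) 1) : 0 ≤ partial₂ C u v :=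
  MonotoneOn.derivWithin_nonneg fun _ hx _ hy hxy => hC.mono_right hu hx hy hxy

end IsCopula

/-! ### Partial derivatives on the closed square -/

theorem hasDerivWithinAt_uncurry_comp {C : ℝ → ℝ → ℝ}
    (hC2 : ContDiffOn ℝ 2 (Function.uncurry C) (Icc 0 1 ×ˢ Icc 0 1)) {a b : ℝ → ℝ} {a' b' x : ℝ}
    (hx : x ∈ Icc (0 : ℝ) 1)
    (ha : HasDerivWithinAt a a' (Icc 0 1) x) (hb : HasDerivWithinAt b b' (Icc 0 1) x)
    (ham : MapsTo a (Icc 0 1) (Icc 0 1)) (hbm : MapsTo b (Icc 0 1) (Icc 0 1)) :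
    HasDerivWithinAt (fun t => C (a t) (b t))
      (fderivWithin ℝ (Function.uncurry C) (Icc 0 1 ×ˢ Icc 0 1) (a x, b x) (a', b'))
      (Icc 0 1) x := by
  have hF := ((hC2.differentiableOn (by norm_num)) (a x, b x) ⟨ham hx, hbm hx⟩).hasFDerivWithinAt
  exact hF.comp_hasDerivWithinAt (f := fun t => (a t, b t)) x (ha.prodMk hb)
    fun t ht => ⟨ham ht, hbm ht⟩

theorem partial₁_eq_fderivWithin {C : ℝ → ℝ → ℝ}
    (hC2 : ContDiffOn ℝ 2 (Function.uncurry C) (Icc 0 1 ×ˢ Icc 0 1)) {u v : ℝ}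
    (hu : u ∈ Icc (0 : ℝ) 1) (hv : v ∈ Icc (0 : ℝ) 1) :
    partial₁ C u v = fderivWithin ℝ (Function.uncurry C) (Icc 0 1 ×ˢ Icc 0 1) (u, v) (1, 0) :=
  (hasDerivWithinAt_uncurry_comp hC2 hu (hasDerivWithinAt_id _ _) (hasDerivWithinAt_const _ _ v)
    (mapsTo_id _) fun _ _ => hv).derivWithin (uniqueDiffOn_Icc zero_lt_one u hu)

theorem partial₂_eq_fderivWithin {C : ℝ → ℝ → ℝ}
    (hC2 : ContDiffOn ℝ 2 (Function.uncurry C) (Icc 0 1 ×ˢ Icc 0 1)) {u v : ℝ}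
    (hu : u ∈ Icc (0 : ℝ) 1) (hv : v ∈ Icc (0 : ℝ) 1) :
    partial₂ C u v = fderivWithin ℝ (Function.uncurry C) (Icc 0 1 ×ˢ Icc 0 1) (u, v) (0, 1) :=
  (hasDerivWithinAt_uncurry_comp hC2 hv (hasDerivWithinAt_const _ _ u) (hasDerivWithinAt_id _ _)
    (fun _ _ => hu) (mapsTo_id _)).derivWithin (uniqueDiffOn_Icc zero_lt_one v hv)

theorem hasDerivWithinAt_comp_partial {C : ℝ → ℝ → ℝ}
    (hC2 : ContDiffOn ℝ 2 (Function.uncurry C) (Icc 0 1 ×ˢ Icc 0 1)) {a b : ℝ → ℝ} {a' b' x : ℝ}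
    (hx : x ∈ Icc (0 : ℝ) 1)
    (ha : HasDerivWithinAt a a' (Icc 0 1) x) (hb : HasDerivWithinAt b b' (Icc 0 1) x)
    (ham : MapsTo a (Icc 0 1) (Icc 0 1)) (hbm : MapsTo b (Icc 0 1) (Icc 0 1)) :
    HasDerivWithinAt (fun t => C (a t) (b t))
      (partial₁ C (a x) (b x) * a' + partial₂ C (a x) (b x) * b') (Icc 0 1) x := by
  have h := hasDerivWithinAt_uncurry_comp hC2 hx ha hb ham hbm
  rw [partial₁_eq_fderivWithin hC2 (ham hx) (hbm hx), partial₂_eq_fderivWithin hC2 (ham hx) (hbm hx)]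
  convert h using 1
  have : ((a', b') : ℝ × ℝ) = a' • (1, 0) + b' • (0, 1) := by simp
  rw [this, map_add, map_smul, map_smul, smul_eq_mul, smul_eq_mul]
  ring

theorem exists_lipschitzOnWith_fderivWithin_apply {C : ℝ → ℝ → ℝ}
    (hC2 : ContDiffOn ℝ 2 (Function.uncurry C) (Icc 0 1 ×ˢ Icc 0 1)) (w : ℝ × ℝ) :
    ∃ K, LipschitzOnWith K
      (fun p => fderivWithin ℝ (Function.uncurry C) (Icc 0 1 ×ˢ Icc 0 1) p w)
      (Icc 0 1 ×ˢ Icc 0 1) := by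
  have hud : UniqueDiffOn ℝ (Icc (0 : ℝ) 1 ×ˢ Icc (0 : ℝ) 1) :=
    (uniqueDiffOn_Icc zero_lt_one).prod (uniqueDiffOn_Icc zero_lt_one)
  have h1 : ContDiffOn ℝ 1 (fderivWithin ℝ (Function.uncurry C) (Icc 0 1 ×ˢ Icc 0 1))
      (Icc 0 1 ×ˢ Icc 0 1) := hC2.fderivWithin hud (by norm_num)
  exact (h1.clm_apply contDiffOn_const).exists_lipschitzOnWith one_ne_zero
    ((convex_Icc _ _).prod (convex_Icc _ _)) (isCompact_Icc.prod isCompact_Icc)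

theorem exists_lipschitzOnWith_partial₁ {C : ℝ → ℝ → ℝ}
    (hC2 : ContDiffOn ℝ 2 (Function.uncurry C) (Icc 0 1 ×ˢ Icc 0 1)) :
    ∃ K, LipschitzOnWith K (Function.uncurry (partial₁ C)) (Icc 0 1 ×ˢ Icc 0 1) := by
  obtain ⟨K, hK⟩ := exists_lipschitzOnWith_fderivWithin_apply hC2 (1, 0)
  exact ⟨K, fun p hp q hq => by
    simpa only [Function.uncurry, partial₁_eq_fderivWithin hC2 hp.1 hp.2,
      partial₁_eq_fderivWithin hC2 hq.1 hq.2] using hK hp hq⟩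

theorem exists_lipschitzOnWith_partial₂ {C : ℝ → ℝ → ℝ}
    (hC2 : ContDiffOn ℝ 2 (Function.uncurry C) (Icc 0 1 ×ˢ Icc 0 1)) :
    ∃ K, LipschitzOnWith K (Function.uncurry (partial₂ C)) (Icc 0 1 ×ˢ Icc 0 1) := by
  obtain ⟨K, hK⟩ := exists_lipschitzOnWith_fderivWithin_apply hC2 (0, 1)
  exact ⟨K, fun p hp q hq => by
    simpa only [Function.uncurry, partial₂_eq_fderivWithin hC2 hp.1 hp.2,
      partial₂_eq_fderivWithin hC2 hq.1 hq.2] using hK hp hq⟩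

theorem _root_.LipschitzOnWith.uncurry_left {F : ℝ → ℝ → ℝ} {K : NNReal} {s t : Set ℝ}
    (h : LipschitzOnWith K (Function.uncurry F) (s ×ˢ t)) {y : ℝ} (hy : y ∈ t) :
    LipschitzOnWith K (fun x => F x y) s :=
  LipschitzOnWith.of_dist_le_mul fun a ha b hb => by
    simpa [Prod.dist_eq] using h.dist_le_mul (a, y) ⟨ha, hy⟩ (b, y) ⟨hb, hy⟩

theorem _root_.LipschitzOnWith.uncurry_right {F : ℝ → ℝ → ℝ} {K : NNReal} {s t : Set ℝ}
    (h : LipschitzOnWith K (Function.uncurry F) (s ×ˢ t)) {x : ℝ} (hx : x ∈ s) :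
    LipschitzOnWith K (fun y => F x y) t :=
  LipschitzOnWith.of_dist_le_mul fun a ha b hb => by
    simpa [Prod.dist_eq] using h.dist_le_mul (x, a) ⟨hx, ha⟩ (x, b) ⟨hx, hb⟩

/-! ### The pseudo-inverse -/

section PseudoInverse

variable {φ : ℝ → ℝ}

theorem pseudoInverse_apply (hφ : φ ∈ classPhi) {x : ℝ} (hx : x ∈ Icc (0 : ℝ) 1) :
    pseudoInverse φ (φ x) = x := by
  obtain ⟨-, -, hmono, -⟩ := hφ
  have h0 : (0 : ℝ) ∈ Icc (0 : ℝ) 1 := by simp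
  unfold pseudoInverse
  split_ifs with h
  · exact le_antisymm hx.1 ((hmono.le_iff_le hx h0).1 h)
  · exact hmono.injOn.leftInvOn_invFunOn hx

theorem exists_apply_eq (hφ : φ ∈ classPhi) {y : ℝ} (hy : y ∈ Icc (φ 0) 1) :
    ∃ x ∈ Icc (0 : ℝ) 1, φ x = y := by
  obtain ⟨-, hcont, -, h1⟩ := hφ
  exact intermediate_value_Icc zero_le_one hcont (by rwa [h1])

theorem apply_pseudoInverse (hφ : φ ∈ classPhi) {y : ℝ} (hy : y ∈ Icc (φ 0) 1) :
    φ (pseudoInverse φ y) = y := by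
  obtain ⟨x, hx, rfl⟩ := exists_apply_eq hφ hy
  rw [pseudoInverse_apply hφ hx]

theorem pseudoInverse_mem (hφ : φ ∈ classPhi) {y : ℝ} (hy : y ≤ 1) :
    pseudoInverse φ y ∈ Icc (0 : ℝ) 1 := by
  rcases le_total y (φ 0) with h | h
  · simp [pseudoInverse, h]
  · obtain ⟨x, hx, rfl⟩ := exists_apply_eq hφ ⟨h, hy⟩
    rwa [pseudoInverse_apply hφ hx]

theorem pseudoInverse_monotoneOn (hφ : φ ∈ classPhi) : MonotoneOn (pseudoInverse φ) (Iic 1) := by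
  intro a ha b hb hab
  rcases le_total a (φ 0) with h | h
  · have : pseudoInverse φ a = 0 := by simp [pseudoInverse, h]
    rw [this]
    exact (pseudoInverse_mem hφ hb).1
  · obtain ⟨x, hx, rfl⟩ := exists_apply_eq hφ ⟨h, ha⟩
    obtain ⟨y, hy, rfl⟩ := exists_apply_eq hφ ⟨h.trans hab, hb⟩
    rw [pseudoInverse_apply hφ hx, pseudoInverse_apply hφ hy]
    exact (hφ.2.2.1.le_iff_le hx hy).1 hab

theorem pseudoInverse_continuousOn (hφ : φ ∈ classPhi) :
    ContinuousOn (pseudoInverse φ) (Iic 1) := by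
  -- Truncated at `1`, the pseudo-inverse is a monotone surjection of the line onto `[0, 1]`.
  let G : ℝ → Icc (0 : ℝ) 1 := fun t => ⟨pseudoInverse φ (min t 1),
    pseudoInverse_mem hφ (min_le_right _ _)⟩
  have hmono : Monotone G := fun a b hab => Subtype.mk_le_mk.2
    (pseudoInverse_monotoneOn hφ (mem_Iic.2 (min_le_right _ _)) (mem_Iic.2 (min_le_right _ _))
      (min_le_min_right _ hab))
  have hsurj : Function.Surjective G := fun x => ⟨φ x, Subtype.ext (by
    simp only [G]
    rw [min_eq_left (hφ.1 x.2).2, pseudoInverse_apply hφ x.2])⟩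
  have hcont := continuous_subtype_val.comp (hmono.continuous_of_surjective hsurj)
  refine hcont.continuousOn.congr fun t ht => ?_
  simp only [G, Function.comp_apply]
  rw [min_eq_left ht]

theorem mul_sub_le_of_concaveOn (hφd : DifferentiableOn ℝ φ (Icc 0 1))
    (hconc : ConcaveOn ℝ (Icc 0 1) φ) {x y z : ℝ} (hx : x ∈ Icc (0 : ℝ) 1)
    (hz : z ∈ Icc (0 : ℝ) 1) (hxy : x ≤ y) (hyz : y ≤ z) :
    derivWithin φ (Icc 0 1) z * (y - x) ≤ φ y - φ x := by
  have hy : y ∈ Icc (0 : ℝ) 1 := ⟨hx.1.trans hxy, hyz.trans hz.2⟩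
  rcases hxy.eq_or_lt with rfl | hlt
  · simp
  have h1 := hconc.derivWithin_le_slope hx hy hlt (hφd y hy)
  have h2 := hconc.antitoneOn_derivWithin hφd hy hz hyz
  rw [slope_def_field, le_div_iff₀ (sub_pos.2 hlt)] at h1
  exact (mul_le_mul_of_nonneg_right h2 (sub_nonneg.2 hxy)).trans h1

theorem derivWithin_pos_of_concaveOn (hφ : φ ∈ classPhi) (hφd : DifferentiableOn ℝ φ (Icc 0 1))
    (hconc : ConcaveOn ℝ (Icc 0 1) φ) {x : ℝ} (hx : x ∈ Ico (0 : ℝ) 1) :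
    0 < derivWithin φ (Icc 0 1) x := by
  have hx' : x ∈ Icc (0 : ℝ) 1 := ⟨hx.1, hx.2.le⟩
  have h1 : (1 : ℝ) ∈ Icc (0 : ℝ) 1 := by simp
  have h := hconc.slope_le_derivWithin hx' h1 hx.2 (hφd x hx')
  refine lt_of_lt_of_le ?_ h
  rw [slope_def_field]
  exact div_pos (sub_pos.2 (hφ.2.2.1 hx' h1 hx.2)) (sub_pos.2 hx.2)

/-- By concavity, `φ^{[-1]}` increases at most `1 / φ'(x)` times as fast as its argument on
`[φ(0), φ(x)]`. -/
theorem mul_pseudoInverse_sub_le (hφ : φ ∈ classPhi) (hφd : DifferentiableOn ℝ φ (Icc 0 1))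
    (hconc : ConcaveOn ℝ (Icc 0 1) φ) {x s t : ℝ} (hx : x ∈ Icc (0 : ℝ) 1) (hs : φ 0 ≤ s)
    (hst : s ≤ t) (htx : t ≤ φ x) :
    derivWithin φ (Icc 0 1) x * (pseudoInverse φ t - pseudoInverse φ s) ≤ t - s := by
  have h1 : φ x ≤ 1 := (hφ.1 hx).2
  have ht1 : t ≤ 1 := htx.trans h1
  have hle : pseudoInverse φ t ≤ x := by
    have := pseudoInverse_monotoneOn hφ ht1 h1 htx
    rwa [pseudoInverse_apply hφ hx] at this
  have := mul_sub_le_of_concaveOn hφd hconc (pseudoInverse_mem hφ (hst.trans ht1)) hx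
    (pseudoInverse_monotoneOn hφ (hst.trans ht1) ht1 hst) hle
  rwa [apply_pseudoInverse hφ ⟨hs.trans hst, ht1⟩, apply_pseudoInverse hφ ⟨hs, hst.trans ht1⟩]
    at this

/-- The derivative of the pseudo-inverse. At a point of `(φ(0), 1]` it does not matter whether
`φ(0) = 0`; at `φ(0)` itself the constant branch on `[0, φ(0)]` has to be trivial. -/
theorem hasDerivWithinAt_pseudoInverse (hφ : φ ∈ classPhi) (hφd : DifferentiableOn ℝ φ (Icc 0 1))
    {y : ℝ} (hy : y ∈ Icc (0 : ℝ) 1) (hy0 : φ 0 = 0 ∨ φ 0 < y)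
    (hne : derivWithin φ (Icc 0 1) (pseudoInverse φ y) ≠ 0) :
    HasDerivWithinAt (pseudoInverse φ) (derivWithin φ (Icc 0 1) (pseudoInverse φ y))⁻¹
      (Icc 0 1) y := by
  have hgm := pseudoInverse_mem hφ hy.2
  have hev : ∀ᶠ x in 𝓝[Icc 0 1] y, φ (pseudoInverse φ x) = x := by
    rcases hy0 with h0 | h0
    · filter_upwards [self_mem_nhdsWithin] with x hx
      exact apply_pseudoInverse hφ ⟨h0.trans_le hx.1, hx.2⟩
    · filter_upwards [self_mem_nhdsWithin, mem_nhdsWithin_of_mem_nhds (Ioi_mem_nhds h0)] with x hx hx'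
      exact apply_pseudoInverse hφ ⟨le_of_lt hx', hx.2⟩
  have hf := (hφd _ hgm).hasDerivWithinAt
  have hcont : Tendsto (pseudoInverse φ) (𝓝[Icc 0 1] y) (𝓝[Icc 0 1] (pseudoInverse φ y)) := by
    refine tendsto_nhdsWithin_iff.2 ⟨?_, ?_⟩
    · exact (pseudoInverse_continuousOn hφ y hy.2).mono Icc_subset_Iic_self
    · filter_upwards [self_mem_nhdsWithin] with x hx using pseudoInverse_mem hφ hx.2
  have hf' : HasFDerivWithinAt φ
      ((ContinuousLinearEquiv.unitsEquivAut ℝ (Units.mk0 _ hne) : ℝ ≃L[ℝ] ℝ) : ℝ →L[ℝ] ℝ)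
      (Icc 0 1) (pseudoInverse φ y) := by
    have he : ((ContinuousLinearEquiv.unitsEquivAut ℝ (Units.mk0 _ hne) : ℝ ≃L[ℝ] ℝ) : ℝ →L[ℝ] ℝ) =
        ContinuousLinearMap.toSpanSingleton ℝ (derivWithin φ (Icc 0 1) (pseudoInverse φ y)) := by
      ext
      simp
    rw [he]
    exact hf.hasFDerivWithinAt
  have := (hf'.of_local_left_inverse hcont hy hev).hasDerivWithinAt
  simpa using this

end PseudoInverse

/-! ### The transformed function -/

section Transformed

variable {C : ℝ → ℝ → ℝ} {φ ψ : ℝ → ℝ}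

theorem transformed_symm (C : ℝ → ℝ → ℝ) (φ ψ : ℝ → ℝ) (u v : ℝ) :
    transformed C φ ψ u v = transformed C φ ψ v u := by
  unfold transformed
  rw [min_comm, max_comm]

theorem transformed_of_le {u v : ℝ} (h : u ≤ v) :
    transformed C φ ψ u v = pseudoInverse φ (C (φ u) (ψ v)) := by
  unfold transformed
  rw [min_eq_left h, max_eq_right h]

theorem transformed_of_ge {u v : ℝ} (h : v ≤ u) :
    transformed C φ ψ u v = pseudoInverse φ (C (φ v) (ψ u)) := by
  rw [transformed_symm, transformed_of_le h]

theorem transformed_le_left (hC : IsCopula C) (hφ : φ ∈ classPhi) (hψ : ψ ∈ classPsi) {u v : ℝ}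
    (hu : u ∈ Icc (0 : ℝ) 1) (hv : v ∈ Icc (0 : ℝ) 1) (huv : u ≤ v) :
    transformed C φ ψ u v ≤ u := by
  rw [transformed_of_le huv]
  have h := pseudoInverse_monotoneOn hφ (mem_Iic.2 (hC.mem_Icc (hφ.1 hu) (hψ.1 hv)).2)
    (mem_Iic.2 (hφ.1 hu).2) (hC.le_left (hφ.1 hu) (hψ.1 hv))
  rwa [pseudoInverse_apply hφ hu] at h

theorem transformed_le_right (hC : IsCopula C) (hφ : φ ∈ classPhi) (hψ : ψ ∈ classPsi) {u v : ℝ}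
    (hu : u ∈ Icc (0 : ℝ) 1) (hv : v ∈ Icc (0 : ℝ) 1) (hvu : v ≤ u) :
    transformed C φ ψ u v ≤ v := by
  rw [transformed_symm]
  exact transformed_le_left hC hφ hψ hv hu hvu

theorem transformed_mem (hC : IsCopula C) (hφ : φ ∈ classPhi) (hψ : ψ ∈ classPsi) {u v : ℝ}
    (hu : u ∈ Icc (0 : ℝ) 1) (hv : v ∈ Icc (0 : ℝ) 1) :
    transformed C φ ψ u v ∈ Icc (0 : ℝ) 1 := by
  rcases le_total u v with h | h
  · rw [transformed_of_le h]
    exact pseudoInverse_mem hφ (hC.mem_Icc (hφ.1 hu) (hψ.1 hv)).2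
  · rw [transformed_of_ge h]
    exact pseudoInverse_mem hφ (hC.mem_Icc (hφ.1 hv) (hψ.1 hu)).2

theorem transformed_one_right (hC : IsCopula C) (hφ : φ ∈ classPhi) (hψ : ψ ∈ classPsi) {u : ℝ}
    (hu : u ∈ Icc (0 : ℝ) 1) : transformed C φ ψ u 1 = u := by
  rw [transformed_of_le hu.2, hψ.2.2.2, hC.one_right _ (hφ.1 hu), pseudoInverse_apply hφ hu]

end Transformed

theorem image_sub_le_of_partial₂_le {C : ℝ → ℝ → ℝ}
    (hC2 : ContDiffOn ℝ 2 (Function.uncurry C) (Icc 0 1 ×ˢ Icc 0 1)) {x v w M : ℝ}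
    (hx : x ∈ Icc (0 : ℝ) 1) (hv : v ∈ Icc (0 : ℝ) 1) (hw : w ∈ Icc (0 : ℝ) 1) (hvw : v ≤ w)
    (hM : ∀ t ∈ Icc v w, partial₂ C x t ≤ M) : C x w - C x v ≤ M * (w - v) := by
  have hd : ∀ t ∈ Icc (0 : ℝ) 1, HasDerivWithinAt (fun t => C x t) (partial₂ C x t) (Icc 0 1) t :=
    fun t ht => by
      simpa using hasDerivWithinAt_comp_partial hC2 ht (hasDerivWithinAt_const t (Icc 0 1) x)
        (hasDerivWithinAt_id t (Icc 0 1)) (fun _ _ => hx) (mapsTo_id _)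
  have hsub : Icc v w ⊆ Icc (0 : ℝ) 1 := Icc_subset_Icc hv.1 hw.2
  have hd' : ∀ t ∈ interior (Icc v w), HasDerivAt (fun t => C x t) (partial₂ C x t) t :=
    fun t ht => by
      rw [interior_Icc] at ht
      exact (hd t (hsub (Ioo_subset_Icc_self ht))).hasDerivAt
        (Icc_mem_nhds (hv.1.trans_lt ht.1) (ht.2.trans_le hw.2))
  refine (convex_Icc v w).image_sub_le_mul_sub_of_deriv_le
    (fun t ht => ((hd t (hsub ht)).continuousWithinAt).mono hsub)
    (fun t ht => (hd' t ht).differentiableAt.differentiableWithinAt) (fun t ht => ?_)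
    v (left_mem_Icc.2 hvw) w (right_mem_Icc.2 hvw) hvw
  rw [(hd' t ht).deriv]
  exact hM t (interior_subset ht)

/-! ### Points of `S` belong to the singular set -/

/-- At a point `(u, u)` of `S`, the part of the diagonal just below `(u, u)` has positive mass. The
point is approached from the left, so that concavity bounds the increments of `φ^{[-1]}` by its
derivative at the end point, and no continuity of `ψ'` is needed. -/
theorem eventually_measureReal_diagonal_pos {C : ℝ → ℝ → ℝ} (hC : IsCopula C)
    (hC2 : ContDiffOn ℝ 2 (Function.uncurry C) (Icc 0 1 ×ˢ Icc 0 1))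
    {φ ψ : ℝ → ℝ} (hφ : φ ∈ classPhi) (hψ : ψ ∈ classPsi)
    (hφd : DifferentiableOn ℝ φ (Icc 0 1)) (hψd : DifferentiableOn ℝ ψ (Icc 0 1))
    (hconc : ConcaveOn ℝ (Icc 0 1) φ) (μ : Measure (ℝ × ℝ)) [IsFiniteMeasure μ]
    (hμ : ∀ u ∈ Icc (0 : ℝ) 1, ∀ v ∈ Icc (0 : ℝ) 1,
      μ.real (Iic u ×ˢ Iic v) = transformed C φ ψ u v) {u : ℝ} (hu : u ∈ Ioc (0 : ℝ) 1)
    (hu₁ : φ 0 < C (φ u) (ψ u))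
    (hu₂ : partial₂ C (φ u) (ψ u) * derivWithin ψ (Icc 0 1) u
      < partial₁ C (φ u) (ψ u) * derivWithin φ (Icc 0 1) u) :
    ∀ᶠ a in 𝓝[<] u, 0 < μ.real ((Ioc a u ×ˢ Ioc a u) ∩ diagonal ℝ) := by
  have huI : u ∈ Icc (0 : ℝ) 1 := ⟨hu.1.le, hu.2⟩
  have hyI := hC.mem_Icc (hφ.1 huI) (hψ.1 huI)
  set c₁ := partial₁ C (φ u) (ψ u)
  set c₂ := partial₂ C (φ u) (ψ u)
  set φ' := derivWithin φ (Icc 0 1) u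
  set ψ' := derivWithin ψ (Icc 0 1) u
  have hψ' : 0 ≤ ψ' := hψ.2.2.1.derivWithin_nonneg
  have hφ' : 0 ≤ φ' := hφ.2.2.1.monotoneOn.derivWithin_nonneg
  have hc₂ : 0 ≤ c₂ := hC.partial₂_nonneg (hφ.1 huI)
  have hx₀I : pseudoInverse φ (C (φ u) (ψ u)) ∈ Icc (0 : ℝ) 1 := pseudoInverse_mem hφ hyI.2
  set x₀ := pseudoInverse φ (C (φ u) (ψ u)) with hx₀
  have hφx₀ : φ x₀ = C (φ u) (ψ u) := apply_pseudoInverse hφ ⟨hu₁.le, hyI.2⟩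
  set q := derivWithin φ (Icc 0 1) x₀
  -- Only at `u = 1` could `φ'` vanish, and there the defining inequality of `S₂` prevents it.
  have hq : 0 < q := by
    rcases hu.2.lt_or_eq with h | h
    · refine derivWithin_pos_of_concaveOn hφ hφd hconc ⟨hx₀I.1, ?_⟩
      have := transformed_le_left hC hφ hψ huI huI le_rfl
      rw [transformed_of_le le_rfl] at this
      exact this.trans_lt h
    · have hx₀u : x₀ = u := by
        have := transformed_one_right hC hφ hψ huI
        rw [h, transformed_of_le le_rfl] at this
        rw [hx₀, h]
        exact this
      have hqφ : q = φ' := by simp only [q, φ', hx₀u]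
      rw [hqφ]
      refine lt_of_le_of_ne hφ' fun h0 => ?_
      rw [← h0, mul_zero] at hu₂
      exact absurd hu₂ (not_lt.2 (mul_nonneg hc₂ hψ'))
  -- `c₂ + ε` will bound `∂C/∂v` near the point; `ε` leaves the derivative of `F` below positive.
  set ε := (c₁ * φ' - c₂ * ψ') / (4 * (ψ' + 1)) with hε_def
  have hε : 0 < ε := div_pos (sub_pos.2 hu₂) (by positivity)
  have hεψ : 2 * ε * ψ' < c₁ * φ' - c₂ * ψ' := by
    have h1 : ε * (4 * (ψ' + 1)) = c₁ * φ' - c₂ * ψ' := by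
      rw [hε_def]
      field_simp
    nlinarith [mul_nonneg hε.le hψ']
  obtain ⟨K, hK⟩ := exists_lipschitzOnWith_partial₂ hC2
  let F : ℝ → ℝ := fun a => q * pseudoInverse φ (C (φ a) (ψ a)) - 2 * (c₂ + ε) * ψ a
  have hCd : HasDerivWithinAt (fun a => C (φ a) (ψ a)) (c₁ * φ' + c₂ * ψ') (Icc 0 1) u :=
    hasDerivWithinAt_comp_partial hC2 huI (hφd u huI).hasDerivWithinAt (hψd u huI).hasDerivWithinAt
      hφ.1 hψ.1
  have hFd : HasDerivWithinAt F (q * (q⁻¹ * (c₁ * φ' + c₂ * ψ')) - 2 * (c₂ + ε) * ψ')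
      (Icc 0 1) u := by
    refine HasDerivWithinAt.sub ?_ ((hψd u huI).hasDerivWithinAt.const_mul _)
    exact ((hasDerivWithinAt_pseudoInverse hφ hφd hyI (Or.inr hu₁) hq.ne').comp u hCd
      (fun a ha => hC.mem_Icc (hφ.1 ha) (hψ.1 ha))).const_mul q
  have hFpos : 0 < q * (q⁻¹ * (c₁ * φ' + c₂ * ψ')) - 2 * (c₂ + ε) * ψ' := by
    rw [mul_inv_cancel_left₀ hq.ne']
    linarith
  have hle : 𝓝[<] u ≤ 𝓝[Icc 0 1] u := by
    rw [← nhdsWithin_Ioo_eq_nhdsLT hu.1]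
    exact nhdsWithin_mono _ fun x hx => ⟨hx.1.le, hx.2.le.trans hu.2⟩
  have hle' : 𝓝[<] u ≤ 𝓝[Icc 0 1 \ {u}] u := by
    rw [← nhdsWithin_Ioo_eq_nhdsLT hu.1]
    exact nhdsWithin_mono _ fun x hx => ⟨⟨hx.1.le, hx.2.le.trans hu.2⟩, hx.2.ne⟩
  have e1 : ∀ᶠ a in 𝓝[<] u, 0 < slope F u a :=
    ((hasDerivWithinAt_iff_tendsto_slope.1 hFd).mono_left hle').eventually (lt_mem_nhds hFpos)
  have e2 : ∀ᶠ a in 𝓝[<] u, φ 0 < C (φ a) (ψ a) :=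
    (hCd.continuousWithinAt.mono_left hle).eventually (lt_mem_nhds hu₁)
  have e3 : ∀ᶠ a in 𝓝[<] u, K * (φ u - φ a) < ε := by
    have : Tendsto (fun a => (K : ℝ) * (φ u - φ a)) (𝓝[<] u) (𝓝 (K * (φ u - φ u))) :=
      ((hφ.2.1 u huI).mono_left hle).const_sub _ |>.const_mul _
    rw [sub_self, mul_zero] at this
    exact this.eventually (gt_mem_nhds hε)
  have e4 : ∀ᶠ a in 𝓝[<] u, K * (ψ u - ψ a) < ε := by
    have : Tendsto (fun a => (K : ℝ) * (ψ u - ψ a)) (𝓝[<] u) (𝓝 (K * (ψ u - ψ u))) :=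
      ((hψ.2.1 u huI).mono_left hle).const_sub _ |>.const_mul _
    rw [sub_self, mul_zero] at this
    exact this.eventually (gt_mem_nhds hε)
  filter_upwards [e1, e2, e3, e4, Ioo_mem_nhdsLT hu.1] with a h1 h2 h3 h4 ha
  have hmem : ∀ x, a ≤ x → x ≤ u → x ∈ Icc (0 : ℝ) 1 := fun x h h' =>
    ⟨ha.1.le.trans h, h'.trans hu.2⟩
  have haI := hmem a le_rfl ha.2.le
  have hFa : F a < F u := by
    rw [slope_def_field] at h1
    by_contra! hcon
    exact absurd h1 (not_lt.2 (div_nonpos_of_nonneg_of_nonpos (sub_nonneg.2 hcon)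
      (sub_nonpos.2 ha.2.le)))
  have key := le_measureReal_diagonal μ ha.2.le (G := fun x => q⁻¹ * F x) ?_
  · refine lt_of_lt_of_le ?_ key
    rw [← mul_sub]
    exact mul_pos (inv_pos.2 hq) (sub_pos.2 hFa)
  intro x y hax hxy hyu
  have hxI := hmem x hax (hxy.trans hyu)
  have hyI' := hmem y (hax.trans hxy) hyu
  have hφxu : φ x ≤ φ u := hφ.2.2.1.monotoneOn hxI huI (hxy.trans hyu)
  have hψyu : ψ y ≤ ψ u := hψ.2.2.1 hyI' huI hyu
  have hψxy : ψ x ≤ ψ y := hψ.2.2.1 hxI hyI' hxy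
  have hφax : φ a ≤ φ x := hφ.2.2.1.monotoneOn haI hxI hax
  have hψax : ψ a ≤ ψ x := hψ.2.2.1 haI hxI hax
  have hbound : ∀ t ∈ Icc (ψ x) (ψ y), partial₂ C (φ x) t ≤ c₂ + ε := by
    intro t ht
    have htI : t ∈ Icc (0 : ℝ) 1 := ⟨(hψ.1 hxI).1.trans ht.1, ht.2.trans (hψ.1 hyI').2⟩
    have hd := hK.dist_le_mul (φ x, t) ⟨hφ.1 hxI, htI⟩ (φ u, ψ u) ⟨hφ.1 huI, hψ.1 huI⟩
    have hdist : (K : ℝ) * dist (φ x, t) (φ u, ψ u) ≤ ε := by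
      rw [Prod.dist_eq]
      simp only [Real.dist_eq]
      rw [abs_of_nonpos (sub_nonpos.2 hφxu), abs_of_nonpos (sub_nonpos.2 (ht.2.trans hψyu)),
        mul_max_of_nonneg _ _ K.coe_nonneg]
      refine max_le (le_trans ?_ h3.le) (le_trans ?_ h4.le)
      · exact mul_le_mul_of_nonneg_left (by linarith) K.coe_nonneg
      · exact mul_le_mul_of_nonneg_left (by linarith [ht.1]) K.coe_nonneg
    have h5 := (le_abs_self _).trans (Real.dist_eq _ _ ▸ hd)
    simp only [Function.uncurry_apply_pair] at h5
    change _ ≤ partial₂ C (φ u) (ψ u) + ε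
    linarith
  have hC_le := image_sub_le_of_partial₂_le hC2 (hφ.1 hxI) (hψ.1 hxI) (hψ.1 hyI') hψxy hbound
  have hlow : φ 0 ≤ C (φ x) (ψ x) := h2.le.trans
    ((hC.mono_left (hφ.1 haI) (hφ.1 hxI) (hψ.1 haI) hφax).trans
      (hC.mono_right (hφ.1 hxI) (hψ.1 haI) (hψ.1 hxI) hψax))
  have hup : C (φ x) (ψ y) ≤ φ x₀ := by
    rw [hφx₀]
    exact (hC.mono_left (hφ.1 hxI) (hφ.1 huI) (hψ.1 hyI') hφxu).trans
      (hC.mono_right (hφ.1 huI) (hψ.1 hyI') (hψ.1 huI) hψyu)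
  have hinc := mul_pseudoInverse_sub_le hφ hφd hconc hx₀I hlow
    (hC.mono_right (hφ.1 hxI) (hψ.1 hxI) (hψ.1 hyI') hψxy) hup
  rw [measureReal_Ioc_prod_Ioc μ hxy hxy, hμ y hyI' y hyI', hμ x hxI y hyI', hμ y hyI' x hxI,
    hμ x hxI x hxI, transformed_symm C φ ψ y x, transformed_of_le hxy, transformed_of_le le_rfl,
    transformed_of_le le_rfl]
  simp only [F]
  rw [← mul_sub, inv_mul_le_iff₀ hq]
  linarith

theorem setS_subset_singularSet {C : ℝ → ℝ → ℝ} (hC : IsCopula C)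
    (hC2 : ContDiffOn ℝ 2 (Function.uncurry C) (Icc 0 1 ×ˢ Icc 0 1))
    {φ ψ : ℝ → ℝ} (hφ : φ ∈ classPhi) (hψ : ψ ∈ classPsi)
    (hφd : DifferentiableOn ℝ φ (Icc 0 1)) (hψd : DifferentiableOn ℝ ψ (Icc 0 1))
    (hconc : ConcaveOn ℝ (Icc 0 1) φ) (μ : Measure (ℝ × ℝ)) [IsFiniteMeasure μ]
    (hμ : ∀ u ∈ Icc (0 : ℝ) 1, ∀ v ∈ Icc (0 : ℝ) 1,
      μ.real (Iic u ×ˢ Iic v) = transformed C φ ψ u v) :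
    setS C φ ψ ⊆ singularSet μ := by
  rintro _ ⟨⟨-, -, h1⟩, u, hu, rfl, h2⟩
  simp only [min_self, max_self] at h1
  have hu0 : u ∈ Ioc (0 : ℝ) 1 := by
    refine ⟨lt_of_le_of_ne hu.1 ?_, hu.2⟩
    rintro rfl
    exact absurd h1 (not_lt.2 (hC.le_left (hφ.1 hu) (hψ.1 hu)))
  rw [singularSet, Measure.mem_support_iff_forall]
  intro N hN
  have hev := eventually_measureReal_diagonal_pos hC hC2 hφ hψ hφd hψd hconc μ hμ hu0 h1 h2
  obtain ⟨δ, hδ, hball⟩ := Metric.mem_nhds_iff.1 hN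
  obtain ⟨a, ha, haδ⟩ := (hev.and (Ioo_mem_nhdsLT (sub_lt_self u hδ))).exists
  have hsub : Ioc a u ×ˢ Ioc a u ⊆ N := by
    refine subset_trans (fun p hp => ?_) hball
    have h3 := hp.1.1
    have h4 := hp.1.2
    have h5 := hp.2.1
    have h6 := hp.2.2
    have h7 := haδ.1
    rw [Metric.mem_ball, Prod.dist_eq, max_lt_iff, Real.dist_eq, Real.dist_eq, abs_lt, abs_lt]
    refine ⟨⟨?_, ?_⟩, ?_, ?_⟩ <;> simp only <;> linarith
  calc 0 < μ ((Ioc a u ×ˢ Ioc a u) ∩ diagonal ℝ) := (ENNReal.toReal_pos_iff.1 ha).1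
    _ = singularMeasure μ ((Ioc a u ×ˢ Ioc a u) ∩ diagonal ℝ) :=
        (singularMeasure_inter_diagonal μ _).symm
    _ ≤ singularMeasure μ N := measure_mono (inter_subset_left.trans hsub)

/-! ### The first-order partial derivative of the transformed function -/

section Partial

variable {C : ℝ → ℝ → ℝ} {φ ψ : ℝ → ℝ}

theorem derivWithin_transformed_ge (hC : IsCopula C) (hφ : φ ∈ classPhi) (hψ : ψ ∈ classPsi)
    (hφd : DifferentiableOn ℝ φ (Icc 0 1)) (hconc : ConcaveOn ℝ (Icc 0 1) φ) {s t : ℝ}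
    (hs : s ∈ Icc (0 : ℝ) 1) (ht : t ∈ Icc (0 : ℝ) 1) :
    derivWithin φ (Icc 0 1) s ≤ derivWithin φ (Icc 0 1) (transformed C φ ψ s t) := by
  refine hconc.antitoneOn_derivWithin hφd (transformed_mem hC hφ hψ hs ht) hs ?_
  rcases le_total s t with h | h
  · exact transformed_le_left hC hφ hψ hs ht h
  · exact (transformed_le_right hC hφ hψ hs ht h).trans h

theorem transformed_monotoneOn_right (hC : IsCopula C) (hφ : φ ∈ classPhi) (hψ : ψ ∈ classPsi)
    {s : ℝ} (hs : s ∈ Icc (0 : ℝ) 1) : MonotoneOn (transformed C φ ψ s) (Icc 0 1) := by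
  intro t ht t' ht' htt'
  have hm : ∀ r ∈ Icc (0 : ℝ) 1, min s r ∈ Icc (0 : ℝ) 1 ∧ max s r ∈ Icc (0 : ℝ) 1 := fun r hr =>
    ⟨⟨le_min hs.1 hr.1, (min_le_left _ _).trans hs.2⟩,
      ⟨hs.1.trans (le_max_left _ _), max_le hs.2 hr.2⟩⟩
  obtain ⟨h1, h2⟩ := hm t ht
  obtain ⟨h3, h4⟩ := hm t' ht'
  refine pseudoInverse_monotoneOn hφ (mem_Iic.2 (hC.mem_Icc (hφ.1 h1) (hψ.1 h2)).2)
    (mem_Iic.2 (hC.mem_Icc (hφ.1 h3) (hψ.1 h4)).2) ?_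
  exact (hC.mono_left (hφ.1 h1) (hφ.1 h3) (hψ.1 h2)
      (hφ.2.2.1.monotoneOn h1 h3 (min_le_min_left _ htt'))).trans
    (hC.mono_right (hφ.1 h3) (hψ.1 h2) (hψ.1 h4) (hψ.2.2.1 h2 h4 (max_le_max_left _ htt')))

/-- Above the diagonal, `H(s, t) = φ⁻¹(C(φ(s), ψ(t)))` is differentiated in `s` by the chain rule. As
`H(s, t) ≤ s < 1`, the denominator `φ'(H(s, t))` is positive. -/
theorem hasDerivAt_transformed_of_lt (hC : IsCopula C)
    (hC2 : ContDiffOn ℝ 2 (Function.uncurry C) (Icc 0 1 ×ˢ Icc 0 1))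
    (hφ : φ ∈ classPhi) (hψ : ψ ∈ classPsi) (hφd : DifferentiableOn ℝ φ (Icc 0 1))
    (hconc : ConcaveOn ℝ (Icc 0 1) φ) (hφ0 : φ 0 = 0) {s t : ℝ} (hs : 0 < s) (hst : s < t)
    (ht : t < 1) :
    HasDerivAt (fun s' => transformed C φ ψ s' t)
      (partial₁ C (φ s) (ψ t) * derivWithin φ (Icc 0 1) s *
        (derivWithin φ (Icc 0 1) (transformed C φ ψ s t))⁻¹) s := by
  have hsI : s ∈ Icc (0 : ℝ) 1 := ⟨hs.le, (hst.trans ht).le⟩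
  have htI : t ∈ Icc (0 : ℝ) 1 := ⟨(hs.trans hst).le, ht.le⟩
  have hpos := derivWithin_pos_of_concaveOn hφ hφd hconc ⟨hs.le, hst.trans ht⟩
  have hge := derivWithin_transformed_ge hC hφ hψ hφd hconc hsI htI
  have hne := (hpos.trans_le hge).ne'
  have hCd := hasDerivWithinAt_comp_partial hC2 hsI (hφd s hsI).hasDerivWithinAt
    (hasDerivWithinAt_const s (Icc 0 1) (ψ t)) hφ.1 (fun _ _ => hψ.1 htI)
  rw [transformed_of_le hst.le] at hne ⊢
  have h := (hasDerivWithinAt_pseudoInverse hφ hφd (hC.mem_Icc (hφ.1 hsI) (hψ.1 htI)) (Or.inl hφ0)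
    hne).comp s hCd (fun a ha => hC.mem_Icc (hφ.1 ha) (hψ.1 htI))
  have h' := h.hasDerivAt (Icc_mem_nhds hs (hst.trans ht))
  rw [mul_zero, add_zero, mul_comm] at h'
  refine h'.congr_of_eventuallyEq ?_
  filter_upwards [Iio_mem_nhds hst] with x hx using transformed_of_le (le_of_lt hx)

theorem hasDerivAt_transformed_of_gt (hC : IsCopula C)
    (hC2 : ContDiffOn ℝ 2 (Function.uncurry C) (Icc 0 1 ×ˢ Icc 0 1))
    (hφ : φ ∈ classPhi) (hψ : ψ ∈ classPsi) (hφd : DifferentiableOn ℝ φ (Icc 0 1))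
    (hψd : DifferentiableOn ℝ ψ (Icc 0 1))
    (hconc : ConcaveOn ℝ (Icc 0 1) φ) (hφ0 : φ 0 = 0) {s t : ℝ} (ht : 0 < t) (hts : t < s)
    (hs : s < 1) :
    HasDerivAt (fun s' => transformed C φ ψ s' t)
      (partial₂ C (φ t) (ψ s) * derivWithin ψ (Icc 0 1) s *
        (derivWithin φ (Icc 0 1) (transformed C φ ψ s t))⁻¹) s := by
  have hsI : s ∈ Icc (0 : ℝ) 1 := ⟨(ht.trans hts).le, hs.le⟩
  have htI : t ∈ Icc (0 : ℝ) 1 := ⟨ht.le, (hts.trans hs).le⟩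
  have hpos := derivWithin_pos_of_concaveOn hφ hφd hconc ⟨hsI.1, hs⟩
  have hge := derivWithin_transformed_ge hC hφ hψ hφd hconc hsI htI
  have hne := (hpos.trans_le hge).ne'
  have hCd := hasDerivWithinAt_comp_partial hC2 hsI (hasDerivWithinAt_const s (Icc 0 1) (φ t))
    (hψd s hsI).hasDerivWithinAt (fun _ _ => hφ.1 htI) hψ.1
  rw [transformed_of_ge hts.le] at hne ⊢
  have h := (hasDerivWithinAt_pseudoInverse hφ hφd (hC.mem_Icc (hφ.1 htI) (hψ.1 hsI)) (Or.inl hφ0)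
    hne).comp s hCd (fun a ha => hC.mem_Icc (hφ.1 htI) (hψ.1 ha))
  have h' := h.hasDerivAt (Icc_mem_nhds (ht.trans hts) hs)
  rw [mul_zero, zero_add, mul_comm] at h'
  refine h'.congr_of_eventuallyEq ?_
  filter_upwards [Ioi_mem_nhds hts] with x hx using transformed_of_ge (le_of_lt hx)

theorem exists_lipschitzOnWith_copula
    (hC2 : ContDiffOn ℝ 2 (Function.uncurry C) (Icc 0 1 ×ˢ Icc 0 1)) :
    ∃ K, LipschitzOnWith K (Function.uncurry C) (Icc 0 1 ×ˢ Icc 0 1) :=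
  hC2.exists_lipschitzOnWith two_ne_zero ((convex_Icc _ _).prod (convex_Icc _ _))
    (isCompact_Icc.prod isCompact_Icc)

theorem pseudoInverse_lipschitzOnWith (hφ : φ ∈ classPhi) (hφd : DifferentiableOn ℝ φ (Icc 0 1))
    (hconc : ConcaveOn ℝ (Icc 0 1) φ) {x : ℝ} (hx : x ∈ Ico (0 : ℝ) 1) :
    ∃ K, LipschitzOnWith K (pseudoInverse φ) (Icc (φ 0) (φ x)) := by
  have hxI : x ∈ Icc (0 : ℝ) 1 := ⟨hx.1, hx.2.le⟩
  have hpos := derivWithin_pos_of_concaveOn hφ hφd hconc hx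
  refine ⟨⟨(derivWithin φ (Icc 0 1) x)⁻¹, (inv_pos.2 hpos).le⟩,
    LipschitzOnWith.of_le_add_mul _ fun s hs t ht => ?_⟩
  change pseudoInverse φ s ≤ pseudoInverse φ t + (derivWithin φ (Icc 0 1) x)⁻¹ * dist s t
  have h1 : φ x ≤ 1 := (hφ.1 hxI).2
  rcases le_total s t with hst | hst
  · have := pseudoInverse_monotoneOn hφ (mem_Iic.2 (hs.2.trans h1)) (mem_Iic.2 (ht.2.trans h1)) hst
    have : 0 ≤ (derivWithin φ (Icc 0 1) x)⁻¹ * dist s t :=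
      mul_nonneg (inv_pos.2 hpos).le dist_nonneg
    linarith
  · have h := mul_pseudoInverse_sub_le hφ hφd hconc hxI ht.1 hst hs.2
    rw [Real.dist_eq, abs_of_nonneg (sub_nonneg.2 hst)]
    rw [← le_inv_mul_iff₀ hpos] at h
    linarith

/-- The factor `1 / φ'(H(s, ·))` of the partial derivative of `H` is absolutely continuous where
`H(s, ·)` is, since `H(s, ·)` is monotone and `φ'` is bounded below by `φ'(s)` on its range. -/
theorem inv_derivWithin_transformed_ac (hC : IsCopula C) (hφ : φ ∈ classPhi) (hψ : ψ ∈ classPsi)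
    (hφd : DifferentiableOn ℝ φ (Icc 0 1)) (hconc : ConcaveOn ℝ (Icc 0 1) φ)
    (hφ' : AbsolutelyContinuousOnInterval (derivWithin φ (Icc 0 1)) 0 1) {s a b : ℝ}
    (hs : s ∈ Ico (0 : ℝ) 1) (hab : uIcc a b ⊆ Icc 0 1)
    (hH : AbsolutelyContinuousOnInterval (transformed C φ ψ s) a b) :
    AbsolutelyContinuousOnInterval
      (fun t => (derivWithin φ (Icc 0 1) (transformed C φ ψ s t))⁻¹) a b := by
  have hsI : s ∈ Icc (0 : ℝ) 1 := ⟨hs.1, hs.2.le⟩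
  refine AbsolutelyContinuousOnInterval.inv_of_le
    (derivWithin_pos_of_concaveOn hφ hφd hconc hs) ?_
    fun t ht => derivWithin_transformed_ge hC hφ hψ hφd hconc hsI (hab ht)
  refine hφ'.comp_monotoneOn hH ((transformed_monotoneOn_right hC hφ hψ hsI).mono hab) ?_
  rw [uIcc_of_le zero_le_one]
  exact fun t ht => transformed_mem hC hφ hψ hsI (hab ht)

theorem partial_transformed_ac_right (hC : IsCopula C)
    (hC2 : ContDiffOn ℝ 2 (Function.uncurry C) (Icc 0 1 ×ˢ Icc 0 1))
    (hφ : φ ∈ classPhi) (hψ : ψ ∈ classPsi) (hφd : DifferentiableOn ℝ φ (Icc 0 1))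
    (hψd : DifferentiableOn ℝ ψ (Icc 0 1))
    (hconc : ConcaveOn ℝ (Icc 0 1) φ) (hφ0 : φ 0 = 0)
    (hφ' : AbsolutelyContinuousOnInterval (derivWithin φ (Icc 0 1)) 0 1) {s : ℝ}
    (hs : s ∈ Ioo (0 : ℝ) 1) :
    AbsolutelyContinuousOnInterval (fun t => partial₁ C (φ s) (ψ t) * derivWithin φ (Icc 0 1) s *
        (derivWithin φ (Icc 0 1) (transformed C φ ψ s t))⁻¹) s 1 := by
  have hsI : s ∈ Icc (0 : ℝ) 1 := ⟨hs.1.le, hs.2.le⟩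
  have hsub : Icc s 1 ⊆ Icc (0 : ℝ) 1 := Icc_subset_Icc_left hsI.1
  have hu : uIcc s 1 = Icc s 1 := uIcc_of_le hs.2.le
  have hψac : AbsolutelyContinuousOnInterval ψ s 1 :=
    absolutelyContinuousOnInterval_of_monotoneOn_differentiableOn hs.2.le (hψ.2.2.1.mono hsub)
      (hψd.mono hsub)
  have hψm : MapsTo ψ (uIcc s 1) (Icc 0 1) := hu ▸ fun t ht => hψ.1 (hsub ht)
  obtain ⟨K, hK⟩ := exists_lipschitzOnWith_copula hC2
  obtain ⟨K₁, hK₁⟩ := exists_lipschitzOnWith_partial₁ hC2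
  obtain ⟨L, hL⟩ := pseudoInverse_lipschitzOnWith hφ hφd hconc ⟨hs.1.le, hs.2⟩
  have hCac := (hK.uncurry_right (hφ.1 hsI)).comp_absolutelyContinuousOnInterval hψac hψm
  have hHac : AbsolutelyContinuousOnInterval (transformed C φ ψ s) s 1 := by
    refine (hL.comp_absolutelyContinuousOnInterval hCac fun t ht => ?_).congr fun t ht => ?_
    · rw [hφ0]
      exact ⟨(hC.mem_Icc (hφ.1 hsI) (hψm ht)).1, hC.le_left (hφ.1 hsI) (hψm ht)⟩
    · rw [hu] at ht
      exact (transformed_of_le ht.1).symm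
  have h1 := ((hK₁.uncurry_right (hφ.1 hsI)).comp_absolutelyContinuousOnInterval hψac hψm).const_mul
    (derivWithin φ (Icc 0 1) s)
  refine (h1.mul (inv_derivWithin_transformed_ac hC hφ hψ hφd hconc hφ' ⟨hs.1.le, hs.2⟩
    (hu.trans_subset hsub) hHac)).congr fun t _ => ?_
  simp only [Pi.mul_apply]
  ring

theorem partial_transformed_ac_left (hC : IsCopula C)
    (hC2 : ContDiffOn ℝ 2 (Function.uncurry C) (Icc 0 1 ×ˢ Icc 0 1))
    (hφ : φ ∈ classPhi) (hψ : ψ ∈ classPsi) (hφd : DifferentiableOn ℝ φ (Icc 0 1))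
    (hconc : ConcaveOn ℝ (Icc 0 1) φ) (hφ0 : φ 0 = 0)
    (hφ' : AbsolutelyContinuousOnInterval (derivWithin φ (Icc 0 1)) 0 1) {s : ℝ}
    (hs : s ∈ Ioo (0 : ℝ) 1) :
    AbsolutelyContinuousOnInterval (fun t => partial₂ C (φ t) (ψ s) * derivWithin ψ (Icc 0 1) s *
        (derivWithin φ (Icc 0 1) (transformed C φ ψ s t))⁻¹) 0 s := by
  have hsI : s ∈ Icc (0 : ℝ) 1 := ⟨hs.1.le, hs.2.le⟩
  have hsub : Icc 0 s ⊆ Icc (0 : ℝ) 1 := Icc_subset_Icc_right hsI.2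
  have hu : uIcc 0 s = Icc 0 s := uIcc_of_le hs.1.le
  have hφac : AbsolutelyContinuousOnInterval φ 0 s :=
    absolutelyContinuousOnInterval_of_monotoneOn_differentiableOn hs.1.le
      (hφ.2.2.1.monotoneOn.mono hsub) (hφd.mono hsub)
  have hφm : MapsTo φ (uIcc 0 s) (Icc 0 1) := hu ▸ fun t ht => hφ.1 (hsub ht)
  obtain ⟨K, hK⟩ := exists_lipschitzOnWith_copula hC2
  obtain ⟨K₂, hK₂⟩ := exists_lipschitzOnWith_partial₂ hC2
  obtain ⟨L, hL⟩ := pseudoInverse_lipschitzOnWith hφ hφd hconc ⟨hs.1.le, hs.2⟩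
  have hCac := (hK.uncurry_left (hψ.1 hsI)).comp_absolutelyContinuousOnInterval hφac hφm
  have hHac : AbsolutelyContinuousOnInterval (transformed C φ ψ s) 0 s := by
    refine (hL.comp_absolutelyContinuousOnInterval hCac fun t ht => ?_).congr fun t ht => ?_
    · have hle := hC.le_left (hφm ht) (hψ.1 hsI)
      have hnn := (hC.mem_Icc (hφm ht) (hψ.1 hsI)).1
      rw [hu] at ht
      rw [hφ0]
      exact ⟨hnn, hle.trans (hφ.2.2.1.monotoneOn (hsub ht) hsI ht.2)⟩
    · rw [hu] at ht
      exact (transformed_of_ge ht.2).symm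
  have h1 := ((hK₂.uncurry_left (hψ.1 hsI)).comp_absolutelyContinuousOnInterval hφac hφm).const_mul
    (derivWithin ψ (Icc 0 1) s)
  refine (h1.mul (inv_derivWithin_transformed_ac hC hφ hψ hφd hconc hφ' ⟨hs.1.le, hs.2⟩
    (hu.trans_subset hsub) hHac)).congr fun t _ => ?_
  simp only [Pi.mul_apply]
  ring

end Partial

/-! ### Disintegration of a law with uniform margins -/

theorem eq_restrict_Ioc_of_measureReal_Iic {ν : Measure ℝ} [IsProbabilityMeasure ν]
    (h : ∀ a ∈ Icc (0 : ℝ) 1, ν.real (Iic a) = a) : ν = volume.restrict (Ioc 0 1) := by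
  refine Measure.ext_of_Iic _ _ fun a => ?_
  rw [Measure.restrict_apply measurableSet_Iic]
  have hset : Iic a ∩ Ioc (0 : ℝ) 1 = Ioc 0 (min 1 a) := by
    ext x
    simp only [mem_inter_iff, mem_Iic, mem_Ioc, le_min_iff]
    tauto
  have hI : ∀ a ∈ Icc (0 : ℝ) 1, ν (Iic a) = ENNReal.ofReal a := fun a ha => by
    rw [← h a ha, ofReal_measureReal, h a ha]
  rw [hset, Real.volume_Ioc, sub_zero]
  rcases lt_or_ge a 0 with h0 | h0
  · rw [min_eq_right (h0.le.trans zero_le_one), ENNReal.ofReal_of_nonpos h0.le]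
    refine measure_mono_null (Iic_subset_Iic.2 h0.le) ?_
    rw [hI 0 (by simp), ENNReal.ofReal_zero]
  rcases le_or_gt a 1 with h1 | h1
  · rw [min_eq_right h1, hI a ⟨h0, h1⟩]
  · rw [min_eq_left h1.le, ENNReal.ofReal_one]
    refine le_antisymm prob_le_one ?_
    calc (1 : ENNReal) = ν (Iic 1) := by rw [hI 1 (by simp), ENNReal.ofReal_one]
      _ ≤ ν (Iic a) := measure_mono (Iic_subset_Iic.2 h1.le)

theorem measureReal_Iic_eq_of_rat {ν : Measure ℝ} [IsProbabilityMeasure ν] {k : ℝ → ℝ} {a b : ℝ}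
    (hk : ContinuousOn k (Ioo a b))
    (hν : ∀ r : ℚ, (r : ℝ) ∈ Ioo a b → ν.real (Iic (r : ℝ)) = k r) :
    ∀ t ∈ Ioo a b, ν.real (Iic t) = k t := by
  intro t ht
  let R : Set ℝ := Ioo t b ∩ range ((↑) : ℚ → ℝ)
  have hne : (𝓝[R] t).NeBot := by
    refine mem_closure_iff_nhdsWithin_neBot.1 ?_
    refine closure_minimal (Rat.denseRange_cast.open_subset_closure_inter isOpen_Ioo)
      isClosed_closure ?_
    rw [closure_Ioo ht.2.ne]
    exact left_mem_Icc.2 ht.2.le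
  rw [← ProbabilityTheory.cdf_eq_real]
  have h1 : Tendsto (ProbabilityTheory.cdf ν) (𝓝[R] t) (𝓝 (ProbabilityTheory.cdf ν t)) :=
    ((ProbabilityTheory.cdf ν).right_continuous t).tendsto.mono_left
      (nhdsWithin_mono _ fun x hx => hx.1.1.le)
  have h2 : Tendsto k (𝓝[R] t) (𝓝 (k t)) :=
    (hk t ht).mono_left (nhdsWithin_mono _ fun x hx => ⟨ht.1.trans hx.1.1, hx.1.2⟩)
  refine tendsto_nhds_unique h1 (h2.congr' ?_)
  filter_upwards [self_mem_nhdsWithin] with x hx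
  obtain ⟨⟨hx1, hx2⟩, r, rfl⟩ := hx
  rw [ProbabilityTheory.cdf_eq_real, hν r ⟨ht.1.trans hx1, hx2⟩]

/-- A probability measure on `(0, 1)` whose distribution function is, at the rational points other
than `x`, equal to a function `D` that is absolutely continuous on either side of `x`, has density
`D'` outside the possible atom `x`. -/
theorem restrict_compl_singleton_eq_withDensity {ν : Measure ℝ} [IsProbabilityMeasure ν]
    {D k₁ k₂ : ℝ → ℝ} {x : ℝ} (hx : x ∈ Ioo (0 : ℝ) 1)
    (hk₁ : AbsolutelyContinuousOnInterval k₁ 0 x) (hk₂ : AbsolutelyContinuousOnInterval k₂ x 1)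
    (hD₁ : EqOn D k₁ (Ioo 0 x)) (hD₂ : EqOn D k₂ (Ioo x 1))
    (hν : ∀ r : ℚ, (r : ℝ) ∈ Ioo (0 : ℝ) 1 → (r : ℝ) ≠ x → ν.real (Iic (r : ℝ)) = D r)
    (hν0 : ν (Ioo (0 : ℝ) 1)ᶜ = 0) :
    (∀ᵐ t ∂volume.restrict (Ioo (0 : ℝ) 1), 0 ≤ deriv D t) ∧ IntegrableOn (deriv D) (Ioo 0 1) ∧
      ν.restrict {x}ᶜ =
        (volume.restrict (Ioo 0 1)).withDensity fun t => ENNReal.ofReal (deriv D t) := by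
  have piece : ∀ {k : ℝ → ℝ} {a b : ℝ}, a < b → AbsolutelyContinuousOnInterval k a b →
      EqOn D k (Ioo a b) → Ioo a b ⊆ Ioo 0 1 → x ∉ Ioo a b →
      (∀ᵐ t ∂volume.restrict (Ioo a b), 0 ≤ deriv D t) ∧ IntegrableOn (deriv D) (Ioo a b) ∧
      ν.restrict (Ioo a b) =
        (volume.restrict (Ioo a b)).withDensity fun t => ENNReal.ofReal (deriv D t) := by
    intro k a b hab hk hD hsub hxn
    have hcont : ContinuousOn k (Ioo a b) :=
      hk.continuousOn.mono (by rw [uIcc_of_le hab.le]; exact Ioo_subset_Icc_self)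
    have hall := measureReal_Iic_eq_of_rat (ν := ν) hcont fun r hr => by
      rw [hν r (hsub hr) (fun h => hxn (h ▸ hr)), hD hr]
    obtain ⟨h1, h2, h3⟩ := restrict_Ioo_eq_withDensity_deriv hab hk hall
    have hder : ∀ t ∈ Ioo a b, deriv D t = deriv k t := fun t ht => by
      refine Filter.EventuallyEq.deriv_eq ?_
      filter_upwards [Ioo_mem_nhds ht.1 ht.2] with y hy using hD hy
    refine ⟨?_, h2.congr_fun (fun t ht => (hder t ht).symm) measurableSet_Ioo, ?_⟩
    · filter_upwards [ae_restrict_mem measurableSet_Ioo] with t ht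
      rw [hder t ht]
      exact h1 t ht
    · rw [h3]
      refine withDensity_congr_ae ?_
      filter_upwards [ae_restrict_mem measurableSet_Ioo] with t ht
      rw [hder t ht]
  obtain ⟨p1, p2, p3⟩ := piece hx.1 hk₁ hD₁ (Ioo_subset_Ioo_right hx.2.le) (by simp)
  obtain ⟨q1, q2, q3⟩ := piece hx.2 hk₂ hD₂ (Ioo_subset_Ioo_left hx.1.le) (by simp)
  have hdisj : Disjoint (Ioo 0 x) (Ioo x 1) := by
    rw [Set.disjoint_left]
    exact fun t h1 h2 => lt_asymm h1.2 h2.1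
  have hunion : Ioo 0 x ∪ Ioo x 1 = Ioo 0 1 ∩ {x}ᶜ := by
    ext t
    simp only [mem_union, mem_Ioo, mem_inter_iff, mem_compl_iff, mem_singleton_iff]
    constructor
    · rintro (h | h)
      · exact ⟨⟨h.1, h.2.trans hx.2⟩, h.2.ne⟩
      · exact ⟨⟨hx.1.trans h.1, h.2⟩, h.1.ne'⟩
    · rintro ⟨h, hne⟩
      rcases lt_or_gt_of_ne hne with h' | h'
      · exact Or.inl ⟨h.1, h'⟩
      · exact Or.inr ⟨h', h.2⟩
  have hvol : volume.restrict (Ioo (0 : ℝ) 1) =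
      volume.restrict (Ioo 0 x) + volume.restrict (Ioo x 1) := by
    rw [← Measure.restrict_union hdisj measurableSet_Ioo, hunion]
    refine Measure.restrict_congr_set ?_
    filter_upwards [compl_mem_ae_iff.2 (measure_singleton (μ := volume) x)] with t ht
    exact propext ⟨fun h => ⟨h, ht⟩, fun h => h.1⟩
  have hνeq : ν.restrict {x}ᶜ = ν.restrict (Ioo 0 x) + ν.restrict (Ioo x 1) := by
    rw [← Measure.restrict_union hdisj measurableSet_Ioo, hunion]
    refine Measure.restrict_congr_set ?_
    filter_upwards [show Ioo (0 : ℝ) 1 ∈ ae ν from hν0] with t ht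
    exact propext ⟨fun h => ⟨ht, h⟩, fun h => h.2⟩
  refine ⟨?_, ?_, ?_⟩
  · rw [hvol, ae_add_measure_iff]
    exact ⟨p1, q1⟩
  · rw [IntegrableOn, hvol]
    exact Integrable.add_measure p2 q2
  · rw [hνeq, hvol, p3, q3, withDensity_add_measure]

section Law

variable {μ : Measure (ℝ × ℝ)} [IsProbabilityMeasure μ] {H : ℝ → ℝ → ℝ}

theorem measure_compl_Iic_prod_Iic
    (hμ : ∀ u ∈ Icc (0 : ℝ) 1, ∀ v ∈ Icc (0 : ℝ) 1, μ.real (Iic u ×ˢ Iic v) = H u v)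
    (hone : ∀ u ∈ Icc (0 : ℝ) 1, H u 1 = u) : μ (Iic (1 : ℝ) ×ˢ Iic (1 : ℝ))ᶜ = 0 := by
  have h1 : (1 : ℝ) ∈ Icc (0 : ℝ) 1 := by simp
  rw [prob_compl_eq_zero_iff (measurableSet_Iic.prod measurableSet_Iic), ← ofReal_measureReal,
    hμ 1 h1 1 h1, hone 1 h1, ENNReal.ofReal_one]

theorem fst_eq_restrict_Ioc
    (hμ : ∀ u ∈ Icc (0 : ℝ) 1, ∀ v ∈ Icc (0 : ℝ) 1, μ.real (Iic u ×ˢ Iic v) = H u v)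
    (hone : ∀ u ∈ Icc (0 : ℝ) 1, H u 1 = u) : μ.fst = volume.restrict (Ioc 0 1) := by
  refine eq_restrict_Ioc_of_measureReal_Iic fun a ha => ?_
  refine Eq.trans ?_ ((hμ a ha 1 (by simp)).trans (hone a ha))
  rw [measureReal_def, measureReal_def, Measure.fst_apply measurableSet_Iic]
  congr 1
  refine measure_congr ?_
  filter_upwards [show Iic (1 : ℝ) ×ˢ Iic (1 : ℝ) ∈ ae μ from measure_compl_Iic_prod_Iic hμ hone]
    with p hp
  exact propext ⟨fun h => ⟨h, hp.2⟩, fun h => h.1⟩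

theorem snd_eq_restrict_Ioc
    (hμ : ∀ u ∈ Icc (0 : ℝ) 1, ∀ v ∈ Icc (0 : ℝ) 1, μ.real (Iic u ×ˢ Iic v) = H u v)
    (hsymm : ∀ u v, H u v = H v u)
    (hone : ∀ u ∈ Icc (0 : ℝ) 1, H u 1 = u) : μ.snd = volume.restrict (Ioc 0 1) := by
  refine eq_restrict_Ioc_of_measureReal_Iic fun a ha => ?_
  refine Eq.trans ?_ ((hμ 1 (by simp) a ha).trans ((hsymm 1 a).trans (hone a ha)))
  rw [measureReal_def, measureReal_def, Measure.snd_apply measurableSet_Iic]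
  congr 1
  refine measure_congr ?_
  filter_upwards [show Iic (1 : ℝ) ×ˢ Iic (1 : ℝ) ∈ ae μ from measure_compl_Iic_prod_Iic hμ hone]
    with p hp
  exact propext ⟨fun h => ⟨hp.1, h⟩, fun h => h.2⟩

theorem eq_integral_condKernel
    (hμ : ∀ u ∈ Icc (0 : ℝ) 1, ∀ v ∈ Icc (0 : ℝ) 1, μ.real (Iic u ×ˢ Iic v) = H u v)
    (hfst : μ.fst = volume.restrict (Ioc 0 1)) {s t : ℝ}
    (hs : s ∈ Icc (0 : ℝ) 1) (ht : t ∈ Icc (0 : ℝ) 1) :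
    H s t = ∫ x in (0 : ℝ)..s, (μ.condKernel x).real (Iic t) := by
  have hset : Iic s ∩ Ioc (0 : ℝ) 1 = Ioc 0 s := by
    ext x
    simp only [mem_inter_iff, mem_Iic, mem_Ioc]
    exact ⟨fun h => ⟨h.2.1, h.1⟩, fun h => ⟨h.2, h.1, h.2.trans hs.2⟩⟩
  have hmeas : Measurable fun x => μ.condKernel x (Iic t) :=
    ProbabilityTheory.Kernel.measurable_coe _ measurableSet_Iic
  rw [intervalIntegral.integral_of_le hs.1, ← hμ s hs t ht, measureReal_def,
    ← Measure.setLIntegral_condKernel_eq_measure_prod measurableSet_Iic measurableSet_Iic, hfst,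
    Measure.restrict_restrict measurableSet_Iic, hset]
  exact (integral_toReal hmeas.aemeasurable
    (Eventually.of_forall fun x => measure_lt_top _ _)).symm

/-- Almost every conditional distribution function is given at the rational points by the partial
derivative of the joint distribution function. -/
theorem ae_condKernel_Iic_rat
    (hμ : ∀ u ∈ Icc (0 : ℝ) 1, ∀ v ∈ Icc (0 : ℝ) 1, μ.real (Iic u ×ˢ Iic v) = H u v)
    (hfst : μ.fst = volume.restrict (Ioc 0 1)) :
    ∀ᵐ x, x ∈ Ioo (0 : ℝ) 1 → ∀ r : ℚ, (r : ℝ) ∈ Ioo (0 : ℝ) 1 →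
      (μ.condKernel x).real (Iic (r : ℝ)) = deriv (fun s => H s r) x := by
  have hr : ∀ r : ℚ, ∀ᵐ x, x ∈ Ioo (0 : ℝ) 1 → (r : ℝ) ∈ Ioo (0 : ℝ) 1 →
      (μ.condKernel x).real (Iic (r : ℝ)) = deriv (fun s => H s r) x := by
    intro r
    have hmeas : Measurable fun x => (μ.condKernel x).real (Iic (r : ℝ)) :=
      (ProbabilityTheory.Kernel.measurable_coe _ measurableSet_Iic).ennreal_toReal
    have hint : IntervalIntegrable (fun x => (μ.condKernel x).real (Iic (r : ℝ))) volume 0 1 := by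
      refine (intervalIntegrable_const (c := (1 : ℝ))).mono_fun hmeas.aestronglyMeasurable ?_
      filter_upwards with x
      rw [Real.norm_of_nonneg measureReal_nonneg, norm_one]
      exact measureReal_le_one
    filter_upwards [hint.ae_hasDerivAt_integral] with x hx hxI hrI
    have hd := hx (by rw [uIcc_of_le zero_le_one]; exact Ioo_subset_Icc_self hxI) 0 (by simp)
    refine (HasDerivAt.deriv (hd.congr_of_eventuallyEq ?_)).symm
    filter_upwards [Ioo_mem_nhds hxI.1 hxI.2] with s hs
    exact eq_integral_condKernel hμ hfst (Ioo_subset_Icc_self hs) (Ioo_subset_Icc_self hrI)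
  filter_upwards [ae_all_iff.2 hr] with x hx hxI r hrI using hx r hxI hrI

theorem ae_condKernel_compl_Ioo
    (hfst : μ.fst = volume.restrict (Ioc 0 1)) (hsnd : μ.snd = volume.restrict (Ioc 0 1)) :
    ∀ᵐ x, x ∈ Ioo (0 : ℝ) 1 → μ.condKernel x (Ioo (0 : ℝ) 1)ᶜ = 0 := by
  have h0 : μ (univ ×ˢ (Ioo (0 : ℝ) 1)ᶜ) = 0 := by
    rw [univ_prod, ← Measure.snd_apply measurableSet_Ioo.compl, hsnd, ← restrict_Ioo_eq_restrict_Ioc,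
      Measure.restrict_apply measurableSet_Ioo.compl, compl_inter_self, measure_empty]
  rw [← Measure.setLIntegral_condKernel_eq_measure_prod MeasurableSet.univ measurableSet_Ioo.compl,
    Measure.restrict_univ, hfst, lintegral_eq_zero_iff
      (ProbabilityTheory.Kernel.measurable_coe _ measurableSet_Ioo.compl),
    ← restrict_Ioo_eq_restrict_Ioc] at h0
  exact (ae_restrict_iff' measurableSet_Ioo).1 h0

/-- If `∂H/∂s (s, ·)` is absolutely continuous on either side of the diagonal, then almost every
conditional law has density `∂²H/∂s∂t (s, ·)` off the diagonal. -/
theorem ae_condKernel_restrict_eq_withDensity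
    (hμ : ∀ u ∈ Icc (0 : ℝ) 1, ∀ v ∈ Icc (0 : ℝ) 1, μ.real (Iic u ×ˢ Iic v) = H u v)
    (hsymm : ∀ u v, H u v = H v u) (hone : ∀ u ∈ Icc (0 : ℝ) 1, H u 1 = u)
    (hac : ∀ s ∈ Ioo (0 : ℝ) 1, ∃ k₁ k₂ : ℝ → ℝ, AbsolutelyContinuousOnInterval k₁ 0 s ∧
      AbsolutelyContinuousOnInterval k₂ s 1 ∧
      (∀ t ∈ Ioo 0 s, deriv (fun s' => H s' t) s = k₁ t) ∧
      ∀ t ∈ Ioo s 1, deriv (fun s' => H s' t) s = k₂ t) :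
    ∀ᵐ x ∂volume.restrict (Ioc (0 : ℝ) 1),
      (∀ᵐ t ∂volume.restrict (Ioo (0 : ℝ) 1), 0 ≤ mixedDeriv H x t) ∧
      IntegrableOn (mixedDeriv H x) (Ioo 0 1) ∧
      (μ.condKernel x).restrict {x}ᶜ =
        (volume.restrict (Ioo 0 1)).withDensity fun t => ENNReal.ofReal (mixedDeriv H x t) := by
  have hfst := fst_eq_restrict_Ioc hμ hone
  have hsnd := snd_eq_restrict_Ioc hμ hsymm hone
  rw [← restrict_Ioo_eq_restrict_Ioc, ae_restrict_iff' measurableSet_Ioo]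
  filter_upwards [ae_condKernel_Iic_rat hμ hfst, ae_condKernel_compl_Ioo hfst hsnd] with x h1 h2 hx
  obtain ⟨k₁, k₂, hk₁, hk₂, hD₁, hD₂⟩ := hac x hx
  exact restrict_compl_singleton_eq_withDensity (D := fun t => deriv (fun s' => H s' t) x)
    hx hk₁ hk₂ hD₁ hD₂ (fun r hr _ => h1 hx r hr) (h2 hx)

theorem condKernel_section_compl_diagonal {B : Set (ℝ × ℝ)} (hB : MeasurableSet B) (x : ℝ) :
    μ.condKernel x {y | (x, y) ∈ B ∩ (diagonal ℝ)ᶜ} =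
      (μ.condKernel x).restrict {x}ᶜ (Prod.mk x ⁻¹' B) := by
  rw [Measure.restrict_apply (measurable_prodMk_left hB)]
  congr 1
  ext y
  simp [eq_comm]

theorem restrict_compl_diagonal_absolutelyContinuous
    (hfst : μ.fst = volume.restrict (Ioc 0 1)) {m : ℝ → ℝ → ℝ}
    (h : ∀ᵐ x ∂volume.restrict (Ioc (0 : ℝ) 1), (μ.condKernel x).restrict {x}ᶜ =
      (volume.restrict (Ioo 0 1)).withDensity fun t => ENNReal.ofReal (m x t)) :
    μ.restrict (diagonal ℝ)ᶜ ≪ volume := by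
  refine Measure.AbsolutelyContinuous.mk fun N hN hN0 => ?_
  have hND := hN.inter measurableSet_diagonal_real.compl
  have hmeas : Measurable fun x => μ.condKernel x {y | (x, y) ∈ N ∩ (diagonal ℝ)ᶜ} :=
    ProbabilityTheory.Kernel.measurable_kernel_prodMk_left hND
  rw [Measure.restrict_apply hN, ← Measure.lintegral_condKernel_mem hND, hfst,
    lintegral_eq_zero_iff hmeas]
  rw [Measure.volume_eq_prod, Measure.measure_prod_null hN] at hN0
  filter_upwards [h, ae_restrict_of_ae hN0] with x hx hx0
  rw [condKernel_section_compl_diagonal hN, hx]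
  exact ((withDensity_absolutelyContinuous _ _).trans Measure.absolutelyContinuous_restrict) hx0

/-- The mass off the diagonal as an iterated integral. Only the conditional masses, which are
measurable in the first variable, are integrated, so that `m` need not be jointly measurable. -/
theorem measureReal_restrict_compl_diagonal
    (hfst : μ.fst = volume.restrict (Ioc 0 1)) {m : ℝ → ℝ → ℝ}
    (h : ∀ᵐ x ∂volume.restrict (Ioc (0 : ℝ) 1),
      (∀ᵐ t ∂volume.restrict (Ioo (0 : ℝ) 1), 0 ≤ m x t) ∧ IntegrableOn (m x) (Ioo 0 1) ∧
      (μ.condKernel x).restrict {x}ᶜ =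
        (volume.restrict (Ioo 0 1)).withDensity fun t => ENNReal.ofReal (m x t))
    {u v : ℝ} (hu : u ∈ Icc (0 : ℝ) 1) (hv : v ∈ Icc (0 : ℝ) 1) :
    (μ.restrict (diagonal ℝ)ᶜ).real (Iic u ×ˢ Iic v) =
      ∫ s in (0 : ℝ)..u, ∫ t in (0 : ℝ)..v, m s t := by
  have hB : MeasurableSet (Iic u ×ˢ Iic v) := measurableSet_Iic.prod measurableSet_Iic
  have hBD := hB.inter measurableSet_diagonal_real.compl
  have hset : Ioc (0 : ℝ) 1 ∩ Iic u = Ioc 0 u := by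
    ext x
    simp only [mem_inter_iff, mem_Iic, mem_Ioc]
    exact ⟨fun h => ⟨h.1.1, h.2⟩, fun h => ⟨⟨h.1, h.2.trans hu.2⟩, h.2⟩⟩
  have hmeas : Measurable fun x => μ.condKernel x {y | (x, y) ∈ Iic u ×ˢ Iic v ∩ (diagonal ℝ)ᶜ} :=
    ProbabilityTheory.Kernel.measurable_kernel_prodMk_left hBD
  rw [measureReal_def, Measure.restrict_apply hB, ← Measure.lintegral_condKernel_mem hBD, hfst,
    ← integral_toReal hmeas.aemeasurable (Eventually.of_forall fun x => measure_lt_top _ _),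
    intervalIntegral.integral_of_le hu.1, ← hset, ← setIntegral_indicator measurableSet_Iic]
  refine integral_congr_ae ?_
  filter_upwards [h] with x hx
  rw [condKernel_section_compl_diagonal hB]
  by_cases hxu : x ∈ Iic u
  · have hsec : Prod.mk x ⁻¹' (Iic u ×ˢ Iic v) = Iic v := by
      ext y
      simp only [mem_preimage, mem_prod, mem_Iic, and_iff_right_iff_imp]
      exact fun _ => hxu
    have hrestr : volume.restrict (Iic v ∩ Ioo (0 : ℝ) 1) = volume.restrict (Ioc 0 v) := by
      refine Measure.restrict_congr_set ?_
      filter_upwards [compl_mem_ae_iff.2 (measure_singleton (μ := volume) (1 : ℝ))] with t ht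
      exact propext ⟨fun h => ⟨h.2.1, h.1⟩,
        fun h => ⟨h.2, h.1, lt_of_le_of_ne (h.2.trans hv.2) ht⟩⟩
    rw [indicator_of_mem hxu, hsec, hx.2.2, withDensity_apply _ measurableSet_Iic,
      ← ofReal_integral_eq_lintegral_ofReal (Integrable.restrict (s := Iic v) hx.2.1)
        (ae_restrict_of_ae hx.1),
      Measure.restrict_restrict measurableSet_Iic, hrestr,
      intervalIntegral.integral_of_le hv.1, ENNReal.toReal_ofReal]
    rw [← hrestr, ← Measure.restrict_restrict measurableSet_Iic]
    exact integral_nonneg_of_ae (ae_restrict_of_ae hx.1)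
  · have hsec : Prod.mk x ⁻¹' (Iic u ×ˢ Iic v) = ∅ := by
      ext y
      simp only [mem_preimage, mem_prod, mem_empty_iff_false, iff_false, not_and]
      exact fun h => absurd h hxu
    rw [indicator_of_notMem hxu, hsec, measure_empty, ENNReal.toReal_zero]

end Law

/-! ### The law of the transformed copula -/

theorem isProbabilityMeasure_jointLaw {Ω : Type*} [MeasurableSpace Ω] {P : Measure Ω}
    [IsProbabilityMeasure P] {U V : Ω → ℝ} (hU : Measurable U) (hV : Measurable V) :
    IsProbabilityMeasure (jointLaw P U V) :=
  Measure.isProbabilityMeasure_map (hU.prodMk hV).aemeasurable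

theorem HasJointDistribution.measureReal_jointLaw {Ω : Type*} [MeasurableSpace Ω] {P : Measure Ω}
    {U V : Ω → ℝ} {H : ℝ → ℝ → ℝ} (h : HasJointDistribution P U V H) (hU : Measurable U)
    (hV : Measurable V) {u v : ℝ} (hu : u ∈ Icc (0 : ℝ) 1) (hv : v ∈ Icc (0 : ℝ) 1) :
    (jointLaw P U V).real (Iic u ×ˢ Iic v) = H u v := by
  rw [← h u hu v hv, jointLaw,
    map_measureReal_apply (hU.prodMk hV) (measurableSet_Iic.prod measurableSet_Iic)]
  rfl

/-- For `φ(0) = 0` and `φ'` absolutely continuous, `∂H/∂s (s, ·)` is absolutely continuous on either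
side of the diagonal. -/
theorem exists_partial_transformed_ac {C : ℝ → ℝ → ℝ} {φ ψ : ℝ → ℝ} (hC : IsCopula C)
    (hC2 : ContDiffOn ℝ 2 (Function.uncurry C) (Icc 0 1 ×ˢ Icc 0 1))
    (hφ : φ ∈ classPhi) (hψ : ψ ∈ classPsi) (hφd : DifferentiableOn ℝ φ (Icc 0 1))
    (hψd : DifferentiableOn ℝ ψ (Icc 0 1))
    (hconc : ConcaveOn ℝ (Icc 0 1) φ) (hφ0 : φ 0 = 0)
    (hφ' : AbsolutelyContinuousOnInterval (derivWithin φ (Icc 0 1)) 0 1) {s : ℝ}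
    (hs : s ∈ Ioo (0 : ℝ) 1) :
    ∃ k₁ k₂ : ℝ → ℝ, AbsolutelyContinuousOnInterval k₁ 0 s ∧
      AbsolutelyContinuousOnInterval k₂ s 1 ∧
      (∀ t ∈ Ioo 0 s, deriv (fun s' => transformed C φ ψ s' t) s = k₁ t) ∧
      ∀ t ∈ Ioo s 1, deriv (fun s' => transformed C φ ψ s' t) s = k₂ t :=
  ⟨_, _, partial_transformed_ac_left hC hC2 hφ hψ hφd hconc hφ0 hφ' hs,
    partial_transformed_ac_right hC hC2 hφ hψ hφd hψd hconc hφ0 hφ' hs,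
    fun _ ht => (hasDerivAt_transformed_of_gt hC hC2 hφ hψ hφd hψd hconc hφ0 ht.1 ht.2 hs.2).deriv,
    fun _ ht => (hasDerivAt_transformed_of_lt hC hC2 hφ hψ hφd hconc hφ0 hs.1 ht.1 ht.2).deriv⟩

end TransformedCopula

theorem mainTheorem3
    (C : ℝ → ℝ → ℝ) (hC : TransformedCopula.IsCopula C)
    (hC2 : ContDiffOn ℝ 2 (Function.uncurry C) (Set.Icc 0 1 ×ˢ Set.Icc 0 1))
    (φ ψ : ℝ → ℝ) (hS : (φ, ψ) ∈ TransformedCopula.classS C)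
    (hφ : DifferentiableOn ℝ φ (Set.Icc 0 1)) (hψ : DifferentiableOn ℝ ψ (Set.Icc 0 1))
    (hconc : ConcaveOn ℝ (Set.Icc 0 1) φ)
    {Ω : Type*} [MeasurableSpace Ω] (P : MeasureTheory.Measure Ω)
    [MeasureTheory.IsProbabilityMeasure P] (U V : Ω → ℝ) (hU : Measurable U) (hV : Measurable V)
    (hUV : TransformedCopula.HasJointDistribution P U V (TransformedCopula.transformed C φ ψ)) :
    -- part (1)
    TransformedCopula.setS C φ ψ ⊆
        TransformedCopula.singularSet (TransformedCopula.jointLaw P U V) ∧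
    -- part (2)
    (φ 0 = 0 → (TransformedCopula.setS C φ ψ).Nonempty →
      AbsolutelyContinuousOnInterval (derivWithin φ (Set.Icc 0 1)) 0 1 →
      TransformedCopula.singularMeasure (TransformedCopula.jointLaw P U V)
          TransformedCopula.mainDiagonalᶜ = 0 ∧
      (∀ u ∈ Set.Icc (0 : ℝ) 1, ∀ v ∈ Set.Icc (0 : ℝ) 1,
        TransformedCopula.transformed C φ ψ u v =
          TransformedCopula.singularComponent (TransformedCopula.jointLaw P U V) u v +
            TransformedCopula.acComponent (TransformedCopula.jointLaw P U V) u v ∧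
        TransformedCopula.acComponent (TransformedCopula.jointLaw P U V) u v =
          ∫ s in (0 : ℝ)..u, ∫ t in (0 : ℝ)..v,
            TransformedCopula.mixedDeriv (TransformedCopula.transformed C φ ψ) s t) ∧
      P.real {ω | U ω = V ω} =
        TransformedCopula.singularComponent (TransformedCopula.jointLaw P U V) 1 1 ∧
      TransformedCopula.singularComponent (TransformedCopula.jointLaw P U V) 1 1 =
        1 - TransformedCopula.acComponent (TransformedCopula.jointLaw P U V) 1 1) := by
  obtain ⟨hφc, hψc, -⟩ := hS
  have := TransformedCopula.isProbabilityMeasure_jointLaw (P := P) hU hV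
  have hμ := fun u (hu : u ∈ Set.Icc (0 : ℝ) 1) v (hv : v ∈ Set.Icc (0 : ℝ) 1) =>
    hUV.measureReal_jointLaw hU hV hu hv
  refine ⟨TransformedCopula.setS_subset_singularSet hC hC2 hφc hψc hφ hψ hconc _ hμ,
    fun hφ0 _ hφ' => ?_⟩
  have hone := fun u (hu : u ∈ Set.Icc (0 : ℝ) 1) =>
    TransformedCopula.transformed_one_right hC hφc hψc hu
  have hsymm := TransformedCopula.transformed_symm C φ ψ
  have hfst := TransformedCopula.fst_eq_restrict_Ioc hμ hone
  have hcond := TransformedCopula.ae_condKernel_restrict_eq_withDensity hμ hsymm hone fun s hs =>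
    TransformedCopula.exists_partial_transformed_ac hC hC2 hφc hψc hφ hψ hconc hφ0 hφ' hs
  have hac := TransformedCopula.restrict_compl_diagonal_absolutelyContinuous hfst
    (hcond.mono fun x hx => hx.2.2)
  obtain ⟨hsing, hacm⟩ :=
    TransformedCopula.lebesgueDecomposition_of_restrict_compl_diagonal_ac _ hac
  have hD := TransformedCopula.measurableSet_diagonal_real
  have h1 : (1 : ℝ) ∈ Set.Icc (0 : ℝ) 1 := by simp
  have hsum : ∀ u ∈ Set.Icc (0 : ℝ) 1, ∀ v ∈ Set.Icc (0 : ℝ) 1,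
      TransformedCopula.transformed C φ ψ u v =
        TransformedCopula.singularComponent (TransformedCopula.jointLaw P U V) u v +
          TransformedCopula.acComponent (TransformedCopula.jointLaw P U V) u v := by
    intro u hu v hv
    rw [TransformedCopula.singularComponent, TransformedCopula.acComponent, hsing, hacm,
      ← MeasureTheory.measureReal_add_apply, MeasureTheory.Measure.restrict_add_restrict_compl hD,
      hμ u hu v hv]
  refine ⟨?_, fun u hu v hv => ⟨hsum u hu v hv, ?_⟩, ?_, ?_⟩
  · rw [hsing, MeasureTheory.Measure.restrict_apply' hD]
    have hnull : (TransformedCopula.jointLaw P U V) (Prod.fst ⁻¹' (Set.Ioc (0 : ℝ) 1)ᶜ) = 0 := by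
      rw [← MeasureTheory.Measure.fst_apply measurableSet_Ioc.compl, hfst,
        MeasureTheory.Measure.restrict_apply measurableSet_Ioc.compl, Set.compl_inter_self,
        MeasureTheory.measure_empty]
    refine MeasureTheory.measure_mono_null ?_ hnull
    rintro ⟨x, y⟩ ⟨hp, hxy⟩ hx
    obtain rfl : x = y := hxy
    exact hp ⟨x, Set.Ioc_subset_Icc_self hx, rfl⟩
  · rw [TransformedCopula.acComponent, hacm]
    exact TransformedCopula.measureReal_restrict_compl_diagonal hfst hcond hu hv
  · have hUV_eq : P.real {ω | U ω = V ω} =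
        (TransformedCopula.jointLaw P U V).real (Set.diagonal ℝ) := by
      rw [TransformedCopula.jointLaw, MeasureTheory.map_measureReal_apply (hU.prodMk hV) hD]
      rfl
    rw [hUV_eq, TransformedCopula.singularComponent, hsing, MeasureTheory.measureReal_def,
      MeasureTheory.measureReal_def, MeasureTheory.Measure.restrict_apply' hD]
    congr 1
    refine MeasureTheory.measure_congr ?_
    filter_upwards [show Set.Iic (1 : ℝ) ×ˢ Set.Iic (1 : ℝ) ∈
      MeasureTheory.ae (TransformedCopula.jointLaw P U V) from
        TransformedCopula.measure_compl_Iic_prod_Iic hμ hone] with p hp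
    exact propext ⟨fun h => ⟨hp, h⟩, fun h => h.2⟩
  · have h := hsum 1 h1 1 h1
    rw [hone 1 h1] at h
    linarith
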